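/- Rule 54 on a periodic chain of even length $n$, with sites labelled by the integers in $[-n/2+1,n/2]$: for a configuration $s\in\{0,1\}^n$ let $U_{\mathrm e}$ (resp. $U_{\mathrm o}$) be the map that simultaneously replaces $s_j$ by $s_{j-1}+s_j+s_{j+1}+s_{j-1}s_{j+1} \pmod 2$ at all even (resp. odd) sites $j$. Real functions $a$ of the configuration evolve by $a(0)=a$ and $a(t+1)=a(t)\circ U_{\mathrm e}$ for even $t$, $a(t+1)=a(t)\circ U_{\mathrm o}$ for odd $t$. Let $\rho_x(s)=s_x$, let $\langle\cdot\rangle$ be the average over all $2^n$ configurations with equal weights (the maximum-entropy state), and for $x\in[-n/2+1,n/2]$ and $0\le t<n/2$ put $$C(x,t)=\langle \rho_0(t)\,\rho_x\rangle-\langle\rho_0\rangle^2 .$$ (1) If $x+t$ is even and $(x,t)\ne(0,0)$, then $$C(x,t)=S(x,t):=2^{-t-1}\sum_{m=0}^{(t-|x|-2)/2}4^m\left(2\binom{t-2m-3}{m}-\binom{t-2m-2}{m}\right),$$ where $\binom{k}{m}=0$ for $k<0$ and the sum is empty if its upper limit is negative. If $x+t$ is odd, then $C(x,t)=\langle \rho_0(t+1)\,\rho_x\rangle-\langle\rho_0\rangle^2=S(x,t+1)$.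 In particular $C(x,t)$ does not depend on $n$, as long as $n>2t$. (2) If $x+t$ is even and $|x|<(t+1)/3$, then $$C(x,t)=2^{-2t-3}\left(\Bigl(1+\tfrac{i}{\sqrt7}\Bigr)(-1-i\sqrt7)^t+\Bigl(1-\tfrac{i}{\sqrt7}\Bigr)(-1+i\sqrt7)^t\right).$$ There is a constant $K$ such that $|C(x,t)|\le K\,2^{-t/2}$ for all $n,x,t$ with $|x|<(t+1)/3$, and this rate is exact at the origin: there is $c>0$ with $|C(0,t)|\ge c\,2^{-t/2}$ for infinitely many $t$. (3) As $t\to\infty$ (with chain lengths $n=n_t>2t$ containing the sites considered), the profile has two peaks, moving with velocities $\pm\frac12$, that are Gaussian on the scale $\sqrt t$: for either sign, every $\zeta\in\mathbb R$ and all integers $x_t=\pm\bigl(\tfrac t2+\zeta_t\sqrt t\bigr)$ with $\zeta_t\to\zeta$, $$\lim_{t\to\infty}\sqrt t\;C(x_t,t)=\frac{e^{-4\zeta^2}}{16\sqrt\pi},$$ whereas $\sqrt t\;C(x_t,t)\to0$ whenever $x_t/t\to v$ with $v\ne\pm\frac12$. -/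

import Mathlib

open Filter Topology

noncomputable section

namespace Rule54

/-- Configurations of the periodic chain with `n` sites, each site being empty (`0`) or full (`1`).
The site with integer label `x` is the residue class of `x`. -/
abbrev Config (n : ℕ) : Type := ZMod n → ZMod 2

/-- The local update rule of the cellular automaton Rule 54. -/
def chi (s₁ s₂ s₃ : ZMod 2) : ZMod 2 := s₁ + s₂ + s₃ + s₁ * s₃

/-- One time step: all sites whose label has the same parity as `par` are updated simultaneously,
and the others are left as they are. For even `n` this is the map on configurations given by
`U_e` (for even `par`) and by `U_o` (for odd `par`). -/
def update (n par : ℕ) (s : Config n) : Config n := fun j =>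
  if j.val % 2 = par % 2 then chi (s (j - 1)) (s j) (s (j + 1)) else s j

/-- Classical observables (diagonal operators), given by their values on configurations. -/
abbrev Observable (n : ℕ) : Type := Config n → ℝ

/-- Time evolution of observables: `a(0) = a`, and `a(t+1) = U_e a(t) U_e` for even `t`,
`a(t+1) = U_o a(t) U_o` for odd `t`. As `U_e` and `U_o` are permutation matrices of involutions,
conjugating a diagonal operator is composing its values with the update map. -/
def evolve {n : ℕ} (a : Observable n) : ℕ → Observable n
  | 0 => a
  | t + 1 => fun s => evolve a t (update n t s)

/-- The local density at the site with label `x`. -/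
def density (n : ℕ) (x : ℤ) : Observable n := fun s => if s (x : ZMod n) = 1 then 1 else 0

/-- The maximum-entropy state: all `2 ^ n` configurations are equally likely. -/
def maxEntropy (n : ℕ) : Config n → ℝ := fun _ => 1 / 2 ^ n

/-- Expectation value of the observable `a` in the macroscopic state `p`. -/
def expval {n : ℕ} [NeZero n] (p : Config n → ℝ) (a : Observable n) : ℝ :=
  ∑ s : Config n, a s * p s

/-- The dynamical structure factor `C(x,t) = ⟨ρ_0(t) ρ_x⟩ - ⟨ρ⟩²` in the maximum-entropy state of
the chain with `n` sites. -/
def structureFactor (n : ℕ) [NeZero n] (x : ℤ) (t : ℕ) : ℝ :=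
  expval (maxEntropy n) (fun s => evolve (density n 0) t s * density n x s)
    - expval (maxEntropy n) (density n 0) ^ 2

/-- The chain with `n` sites, labelled by the integers in `[-n/2+1, n/2]`, has even length,
contains the site `x`, and half of its length exceeds the time `t`. -/
def Admissible (n : ℕ) (x : ℤ) (t : ℕ) : Prop :=
  Even n ∧ 2 * t < n ∧ -(n : ℤ) < 2 * x ∧ 2 * x ≤ n

/-- The binomial coefficient, with the convention that it vanishes for negative upper argument. -/
def binom (a : ℤ) (k : ℕ) : ℝ := if a < 0 then 0 else (a.toNat.choose k : ℝ)

/-- `2^{-t-1} ∑_{m=0}^{(t-|x|-2)/2} 4^m (2 binom(t-2m-3, m) - binom(t-2m-2, m))`; the sum is empty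
if its upper limit is negative. -/
def closedForm (x : ℤ) (t : ℕ) : ℝ :=
  (2 : ℝ) ^ (-(t : ℤ) - 1) *
    ∑ m ∈ Finset.range ((((t : ℤ) - |x| - 2) / 2 + 1).toNat),
      (4 : ℝ) ^ m * (2 * binom ((t : ℤ) - 2 * m - 3) m - binom ((t : ℤ) - 2 * m - 2) m)

end Rule54

end

/-! In terms of the spins (-1)^s, C(x,t) is a quarter of a two-spin average. When x + T is even,
freeze each site as soon as the forward light cone of x reaches it. The frozen evolution is a
composition of involutions, so it preserves the uniform measure. It turns the initial configuration
into independent data on the two light rays from x, and `cell` generates the interior of the cone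
from these data. Hence C(q - p, p + q) is a quarter of `corr` at the cell (p, q)
(`structureFactor_eq_corr`), while outside the cone two distinct spins are independent.

The crux is that the nonlinear rule yields a closed linear recurrence, corr(p+1, q+2) = (corr(p+1,
q+1) + corr(p, q)) / 2 for p ≤ q + 1 (`corr_succ_succ`). The remaining terms vanish by
`avg_sgn_column`: far enough up a column, the spin above an empty entry, or above two consecutive
full entries, averages to zero against every function of the lower entries and of the right ray.
These two properties together pass from one column to the next. By Pascal's rule the closed form
obeys the same recurrence (`corr_eq_partialForm`).

For the asymptotics the number M + 1 of summands is held fixed and time varies. The sum f then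
satisfies f(t+2) + f(t+1)/2 + f(t)/2 = `source M t`, a single binomial weight up to the factor 1/16.
The homogeneous equation has roots (-1 ± i√7)/4 of modulus 2^(-1/2). The source is zero for t < 3M +
3, which gives the exact formula in the central region. Elsewhere Duhamel's formula applies; its
kernel decays exponentially and has sum 1/2, so on the scale 1/√t the profile is half the source
(`tendsto_sqrt_mul_profile`). The local limit theorem makes this a Gaussian near |x| = t/2, and
Chebyshev's inequality removes it along other rays. -/

namespace Rule54

/-! ### Spins, uniform averages and the light-cone quadrant -/

/-- The spin `(-1) ^ a` of a site. -/
noncomputable def sgn (a : ZMod 2) : ℝ := if a = 0 then 1 else -1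

/-- Indicator of an empty site. -/
noncomputable def emp (a : ZMod 2) : ℝ := if a = 0 then 1 else 0

/-- Indicator of a full site. -/
noncomputable def occ (a : ZMod 2) : ℝ := if a = 0 then 0 else 1

/-- The average over all configurations. -/
noncomputable def avg {n : ℕ} [NeZero n] (f : Config n → ℝ) : ℝ := (∑ u, f u) / 2 ^ n

/-- The solution of Rule 54 in the light-cone quadrant above the site `x`, with the boundary values
on the two light rays from `x` given by a configuration. -/
def cell {n : ℕ} (x : ZMod n) (u : Config n) : ℕ → ℕ → ZMod 2
  | 0, k => u (x - k)
  | i + 1, 0 => u (x + (i + 1 : ℕ))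
  | i + 1, k + 1 => chi (cell x u i (k + 1)) (cell x u i k) (cell x u (i + 1) k)

/-- The next column of the quadrant, given its lowest entry and the previous column. -/
def nextColumn (b : ZMod 2) (c : ℕ → ZMod 2) : ℕ → ZMod 2
  | 0 => b
  | k + 1 => chi (c (k + 1)) (c k) (nextColumn b c k)

/-- `g` does not depend on the sites `x - j` with `1 ≤ j ≤ Q`, and depends only on the first `m`
entries of its second argument. -/
def Loc {n : ℕ} (x : ZMod n) (Q m : ℕ) (g : Config n → (ℕ → ZMod 2) → ℝ) : Prop :=
  (∀ u c j b, 1 ≤ j → j ≤ Q → g (Function.update u (x - (j : ℕ)) b) c = g u c) ∧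
  (∀ u c c', (∀ i < m, c i = c' i) → g u c = g u c')

theorem zmod_two_cases (a : ZMod 2) : a = 0 ∨ a = 1 := by
  revert a; decide

@[simp] theorem sgn_zero : sgn 0 = 1 := by simp [sgn]
@[simp] theorem sgn_one : sgn 1 = -1 := by simp [sgn]
@[simp] theorem emp_zero : emp 0 = 1 := by simp [emp]
@[simp] theorem emp_one : emp 1 = 0 := by simp [emp]
@[simp] theorem occ_zero : occ 0 = 0 := by simp [occ]
@[simp] theorem occ_one : occ 1 = 1 := by simp [occ]

theorem zmod_two_one_add_one : (1 : ZMod 2) + 1 = 0 := by decide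

theorem sgn_add_one (a : ZMod 2) : sgn (a + 1) = -sgn a := by
  rcases zmod_two_cases a with rfl | rfl
  · simp
  · simp [zmod_two_one_add_one]

theorem chi_comm (a b c : ZMod 2) : chi a b c = chi c b a := by simp only [chi]; ring

section Average

variable {n : ℕ} [NeZero n]

theorem avg_add (f g : Config n → ℝ) : avg (fun u => f u + g u) = avg f + avg g := by
  simp only [avg, Finset.sum_add_distrib, add_div]

theorem avg_sub (f g : Config n → ℝ) : avg (fun u => f u - g u) = avg f - avg g := by
  simp only [avg, Finset.sum_sub_distrib, sub_div]

theorem avg_const_mul (r : ℝ) (f : Config n → ℝ) : avg (fun u => r * f u) = r * avg f := by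
  simp only [avg, ← Finset.mul_sum, mul_div_assoc]

theorem avg_neg (f : Config n → ℝ) : avg (fun u => - f u) = - avg f := by
  simp only [avg, Finset.sum_neg_distrib, neg_div]

theorem avg_const (r : ℝ) : avg (fun _ : Config n => r) = r := by
  have : Fintype.card (Config n) = 2 ^ n := by simp [Config, ZMod.card]
  simp only [avg, Finset.sum_const, Finset.card_univ, this, nsmul_eq_mul]
  push_cast
  field_simp

theorem avg_comp (e : Config n ≃ Config n) (f : Config n → ℝ) :
    avg (fun u => f (e u)) = avg f := by
  simp only [avg, Equiv.sum_comp e f]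

/-- Flipping the spin at `y` preserves the average and reverses the sign of the integrand. -/
theorem avg_sgn_mul_eq_zero (y : ZMod n) (f : Config n → ℝ)
    (hf : ∀ u b, f (Function.update u y b) = f u) : avg (fun u => sgn (u y) * f u) = 0 := by
  have hinv : Function.Involutive (fun u : Config n => Function.update u y (u y + 1)) := by
    intro u
    ext z
    by_cases hz : z = y
    · subst hz
      simp only [Function.update_self, add_assoc]
      rw [zmod_two_one_add_one, add_zero]
    · simp [Function.update_of_ne hz]
  have h := avg_comp hinv.toPerm (fun u => sgn (u y) * f u)
  simp only [Function.Involutive.coe_toPerm, Function.update_self, hf, sgn_add_one, neg_mul,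
    avg_neg] at h
  linarith

end Average

/-! ### Vanishing correlations along the columns of the quadrant -/

section Quadrant

variable {n : ℕ} {x : ZMod n}

theorem cell_zero (u : Config n) (k : ℕ) : cell x u 0 k = u (x - k) := by
  cases k <;> rw [cell]

theorem cell_succ_zero (u : Config n) (i : ℕ) : cell x u (i + 1) 0 = u (x + (i + 1 : ℕ)) := by
  rw [cell]

theorem cell_succ_succ (u : Config n) (i k : ℕ) : cell x u (i + 1) (k + 1) =
    chi (cell x u i (k + 1)) (cell x u i k) (cell x u (i + 1) k) := by
  rw [cell]

theorem cell_succ_eq_nextColumn (u : Config n) (p : ℕ) :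
    cell x u (p + 1) = nextColumn (u (x + (p + 1 : ℕ))) (cell x u p) := by
  funext k
  induction k with
  | zero => rw [cell_succ_zero, nextColumn]
  | succ k ih => rw [cell_succ_succ, nextColumn, ih]

theorem nextColumn_congr (b : ZMod 2) {c c' : ℕ → ZMod 2} {m : ℕ} (h : ∀ i < m, c i = c' i) :
    ∀ i < m, nextColumn b c i = nextColumn b c' i := by
  intro i hi
  induction i with
  | zero => simp [nextColumn]
  | succ k ih => simp only [nextColumn]; rw [ih (by omega), h _ hi, h k (by omega)]

theorem natCast_ne_of_lt {a b : ℕ} (ha : a < n) (hb : b < n) (h : a ≠ b) :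
    (a : ZMod n) ≠ b := by
  intro h'
  rw [ZMod.natCast_eq_natCast_iff', Nat.mod_eq_of_lt ha, Nat.mod_eq_of_lt hb] at h'
  exact h h'

theorem sub_natCast_ne_add_natCast {a b : ℕ} (ha : 1 ≤ a) (h : a + b < n) :
    x - (a : ZMod n) ≠ x + b := by
  intro h'
  have h2 : ((a + b : ℕ) : ZMod n) = (0 : ℕ) := by
    push_cast
    linear_combination -h'
  exact natCast_ne_of_lt h (by omega) (by omega) h2

theorem update_right_of_lt {p Q j : ℕ} (h : p + Q < n) (h1 : 1 ≤ j) (hj : j ≤ Q)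
    (u : Config n) (b : ZMod 2) :
    Function.update u (x - (j : ℕ)) b (x + p) = u (x + p) :=
  Function.update_of_ne (sub_natCast_ne_add_natCast h1 (by omega)).symm _ _

theorem update_left_of_ne {i j : ℕ} (hi : i < n) (hj : j < n) (h : i ≠ j)
    (u : Config n) (b : ZMod 2) :
    Function.update u (x - (j : ℕ)) b (x - i) = u (x - i) := by
  refine Function.update_of_ne (fun h' => natCast_ne_of_lt hi hj h ?_) _ _
  linear_combination -h'

theorem Loc.mono {Q m m' : ℕ} {g : Config n → (ℕ → ZMod 2) → ℝ} (h : Loc x Q m g) (hm : m ≤ m') :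
    Loc x Q m' g :=
  ⟨h.1, fun u c c' hc => h.2 u c c' fun i hi => hc i (by omega)⟩

theorem Loc.mul {Q m : ℕ} {g g' : Config n → (ℕ → ZMod 2) → ℝ} (h : Loc x Q m g)
    (h' : Loc x Q m g') : Loc x Q m (fun u c => g u c * g' u c) :=
  ⟨fun u c j b h1 h2 => by dsimp only; rw [h.1 u c j b h1 h2, h'.1 u c j b h1 h2],
    fun u c c' hc => by dsimp only; rw [h.2 u c c' hc, h'.2 u c c' hc]⟩

theorem loc_entry {Q m i : ℕ} (f : ZMod 2 → ℝ) (hi : i < m) :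
    Loc x Q m (fun _ c => f (c i)) :=
  ⟨fun _ _ _ _ _ _ => rfl, fun _ _ _ hc => by dsimp only; rw [hc i hi]⟩

theorem loc_center {Q m : ℕ} (hQ : Q < n) (f : ZMod 2 → ℝ) :
    Loc x Q m (fun u _ => f (u x)) := by
  refine ⟨fun u _ j b h1 h2 => ?_, fun _ _ _ _ => rfl⟩
  have := update_right_of_lt (p := 0) (x := x) (by omega : 0 + Q < n) h1 h2 u b
  rw [Nat.cast_zero, add_zero] at this
  dsimp only
  rw [this]

theorem Loc.nextColumn {Q m p : ℕ} {g : Config n → (ℕ → ZMod 2) → ℝ} (h : Loc x Q m g)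
    (hp : p + Q < n) :
    Loc x Q m (fun u c => g u (nextColumn (u (x + p)) c)) := by
  refine ⟨fun u c j b h1 h2 => ?_, fun u c c' hc => ?_⟩
  · dsimp only
    rw [update_right_of_lt hp h1 h2, h.1 _ _ _ _ h1 h2]
  · exact h.2 _ _ _ (nextColumn_congr _ hc)

variable [NeZero n]

theorem avg_sgn_first_column {Q q : ℕ} (hq : q + 1 ≤ Q) (hQ : Q < n)
    {g : Config n → (ℕ → ZMod 2) → ℝ} (hg : Loc x Q (q + 1) g) :
    avg (fun u => sgn (cell x u 0 (q + 1)) * g u (cell x u 0)) = 0 := by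
  simp only [cell_zero]
  refine avg_sgn_mul_eq_zero _ (fun u => g u (cell x u 0)) fun u b => ?_
  rw [hg.1 _ _ _ _ (by omega) hq]
  refine hg.2 _ _ _ fun i hi => ?_
  rw [cell_zero, cell_zero, update_left_of_ne (by omega) (by omega) (by omega)]

/-- The column `p` carries no correlations with an empty site below, or with two full sites below,
outside of the light cone of the slow soliton. -/
theorem avg_sgn_column {Q p : ℕ} (hp : p + Q < n) :
    (∀ q, p ≤ q + 1 → q + 1 ≤ Q → ∀ g, Loc x Q (q + 1) g →
      avg (fun u => sgn (cell x u p (q + 1)) * (emp (cell x u p q) * g u (cell x u p))) = 0) ∧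
    (∀ q, p ≤ q + 1 → q + 2 ≤ Q → ∀ g, Loc x Q (q + 2) g →
      avg (fun u => sgn (cell x u p (q + 2)) *
        (occ (cell x u p (q + 1)) * occ (cell x u p q) * g u (cell x u p))) = 0) := by
  induction p with
  | zero =>
    refine ⟨fun q _ hq g hg => ?_, fun q _ hq g hg => ?_⟩
    · exact avg_sgn_first_column hq (by omega) ((loc_entry emp (by omega)).mul hg)
    · exact avg_sgn_first_column hq (by omega)
        (((loc_entry occ (by omega)).mul (loc_entry occ (by omega))).mul hg)
  | succ p ih =>
    obtain ⟨ihA, ihB⟩ := ih (by omega)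
    refine ⟨fun q hpq hq g hg => ?_, fun q hpq hq g hg => ?_⟩
    · have hg' : Loc x Q (q + 1) (fun u c =>
          emp (nextColumn (u (x + (p + 1 : ℕ))) c q) * g u (nextColumn (u (x + (p + 1 : ℕ))) c)) :=
        ((loc_entry emp (by omega)).mul hg).nextColumn (by omega)
      rcases q with _ | r
      -- At the bottom of column 1 there is no entry below to invoke the second claim for;
      -- independence on the left ray is used directly.
      · obtain rfl : p = 0 := by omega
        have h := avg_sgn_first_column hq (by omega)
          ((loc_entry sgn (by omega : 0 < 0 + 1)).mul hg')
        rw [← h]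
        congr 1
        funext u
        rw [cell_succ_succ, cell_succ_eq_nextColumn, nextColumn]
        generalize u (x + ((0 + 1 : ℕ) : ZMod n)) = b
        generalize cell x u 0 (0 + 1) = c1
        generalize cell x u 0 0 = c0
        generalize g u _ = G
        rcases zmod_two_cases b with rfl | rfl <;> rcases zmod_two_cases c0 with rfl | rfl <;>
          rcases zmod_two_cases c1 with rfl | rfl <;> simp [chi, zmod_two_one_add_one]
      -- Write c for column p, d for column p + 1 and q = r + 1. If d_q = 0, then d_{q+1} = c_{q+1}
      -- + c_q, so its spin is the spin of c_{q+1} times `emp` - `occ` of c_q. The `emp` part is the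
      -- first claim for c. In the `occ` part c_q = 1 and d_q = 0 force c_{q-1} = 1, which is the
      -- second claim for c.
      · have h1 := ihA (r + 1) (by omega) hq _ hg'
        have h2 := ihB r (by omega) hq _ hg'
        have h := congrArg₂ (fun a b => a - b) h1 h2
        simp only [sub_zero] at h
        rw [← avg_sub] at h
        rw [← h]
        congr 1
        funext u
        rw [cell_succ_succ u p (r + 1), cell_succ_eq_nextColumn]
        generalize g u _ = G
        rw [nextColumn]
        generalize nextColumn _ _ r = d
        generalize cell x u p (r + 1 + 1) = c2
        generalize cell x u p (r + 1) = c1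
        generalize cell x u p r = c0
        rcases zmod_two_cases d with rfl | rfl <;> rcases zmod_two_cases c0 with rfl | rfl <;>
          rcases zmod_two_cases c1 with rfl | rfl <;> rcases zmod_two_cases c2 with rfl | rfl <;>
            simp [chi, zmod_two_one_add_one]
    -- If d_q = d_{q+1} = 1, then d_{q+2} = c_{q+1} + 1 and c_q = 0, which reduces to the first
    -- claim for c. As d_{q+1} itself involves c_{q+1}, its value in `g` must first be replaced by
    -- the constant 1.
    · have hg' : Loc x Q (q + 1) (fun u c => g u (Function.update c (q + 1) 1)) := by
        refine ⟨fun u c j b h1 h2 => hg.1 _ _ _ _ h1 h2, fun u c c' hc => hg.2 _ _ _ ?_⟩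
        intro i hi
        by_cases h : i = q + 1
        · simp [h]
        · rw [Function.update_of_ne h, Function.update_of_ne h, hc i (by omega)]
      have h := ihA q (by omega) (by omega) _
        (((loc_entry occ (by omega : q < q + 1)).mul hg').nextColumn (p := p + 1) (by omega))
      have h' := congrArg Neg.neg h
      rw [neg_zero, ← avg_neg] at h'
      rw [← h']
      congr 1
      funext u
      rw [cell_succ_succ u p (q + 1), cell_succ_eq_nextColumn]
      by_cases hd : nextColumn (u (x + ((p + 1 : ℕ) : ZMod n))) (cell x u p) (q + 1) = 1
      · have : Function.update (nextColumn (u (x + ((p + 1 : ℕ) : ZMod n))) (cell x u p)) (q + 1) 1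
            = nextColumn (u (x + ((p + 1 : ℕ) : ZMod n))) (cell x u p) := by
          rw [← hd, Function.update_eq_self]
        rw [this]
        generalize g u _ = G
        rw [nextColumn] at hd ⊢
        revert hd
        generalize nextColumn _ _ q = d
        generalize cell x u p (q + 1 + 1) = c2
        generalize cell x u p (q + 1) = c1
        generalize cell x u p q = c0
        rcases zmod_two_cases d with rfl | rfl <;> rcases zmod_two_cases c0 with rfl | rfl <;>
          rcases zmod_two_cases c1 with rfl | rfl <;> rcases zmod_two_cases c2 with rfl | rfl <;>
            simp [chi, zmod_two_one_add_one]
      -- Here d_{q+1} = 0, and the replacement is harmless: with d_q = 1 this forces c_q = 1, so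
      -- both sides vanish.
      · have hd0 := (zmod_two_cases _).resolve_right hd
        rw [hd0]
        rw [nextColumn] at hd0
        revert hd0
        generalize g u _ = G
        generalize g u _ = G'
        generalize nextColumn _ _ q = d
        generalize cell x u p (q + 1) = c1
        generalize cell x u p q = c0
        rcases zmod_two_cases d with rfl | rfl <;> rcases zmod_two_cases c0 with rfl | rfl <;>
          rcases zmod_two_cases c1 with rfl | rfl <;> simp [chi, zmod_two_one_add_one]

end Quadrant

/-! ### Corner correlations and their linear recurrence -/

theorem cell_reflect {n : ℕ} (x : ZMod n) (u : Config n) (p q : ℕ) :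
    cell x (fun y => u (x + x - y)) p q = cell x u q p := by
  induction p generalizing q with
  | zero =>
    rw [cell_zero]
    cases q with
    | zero => rw [cell_zero]; simp
    | succ q => rw [cell_succ_zero]; congr 1; ring
  | succ p ihp =>
    induction q with
    | zero => rw [cell_zero, cell_succ_zero]; congr 1; ring
    | succ q ihq => rw [cell_succ_succ, cell_succ_succ, ihp, ihp, ihq, chi_comm]

theorem sub_natCast_ne_self {n : ℕ} {x : ZMod n} {k : ℕ} (h0 : 1 ≤ k) (h : k < n) : x - k ≠ x := by
  have := sub_natCast_ne_add_natCast (x := x) (a := k) (b := 0) h0 (by omega)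
  simpa using this

section Correlation

variable {n : ℕ} [NeZero n]

/-- The correlation between the spins at the lower corner and inside of the quadrant. -/
noncomputable def corr (x : ZMod n) (p q : ℕ) : ℝ := avg (fun u => sgn (u x) * sgn (cell x u p q))

/-- The right-hand side is arranged so that each term has one of the two forms that `avg_sgn_column`
annihilates: a spin above an empty entry, or above two full entries. The factor involving the next
column only sees entries below `c2`. -/
theorem spin_identity (c0 c1 c2 d : ZMod 2) :
    sgn (chi c2 c1 (chi c1 c0 d)) - 1 / 2 * sgn (chi c1 c0 d) - 1 / 2 * sgn c0 =
      -(sgn c1 * (emp c0 * 1)) + 1 / 2 * (sgn c2 * (emp c1 * (1 + sgn (chi c1 c0 d))))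
        - sgn c2 * (occ c1 * occ c0 * 1) := by
  rcases zmod_two_cases d with rfl | rfl <;> rcases zmod_two_cases c0 with rfl | rfl <;>
    rcases zmod_two_cases c1 with rfl | rfl <;> rcases zmod_two_cases c2 with rfl | rfl <;>
      simp [chi, zmod_two_one_add_one] <;> norm_num

theorem corr_succ_succ (x : ZMod n) {p q : ℕ} (hpq : p ≤ q + 1) (hn : p + q + 3 < n) :
    corr x (p + 1) (q + 2) = 1 / 2 * corr x (p + 1) (q + 1) + 1 / 2 * corr x p q := by
  have hc : ∀ m, Loc x (q + 2) m (fun u _ => sgn (u x)) := fun m => loc_center (by omega) sgn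
  obtain ⟨hA, hB⟩ := avg_sgn_column (x := x) (Q := q + 2) (p := p) (by omega)
  have h1 := hA q hpq (by omega) _ (hc _)
  have h3 := hB q hpq (by omega) _ (hc _)
  have hl : Loc x (q + 2) (q + 2) (fun u c =>
      sgn (u x) * (1 + sgn (nextColumn (u (x + (p + 1 : ℕ))) c (q + 1)))) :=
    (hc _).mul ((loc_entry (fun a => 1 + sgn a) (by omega : q + 1 < q + 2)).nextColumn (by omega))
  have h2 := hA (q + 1) (by omega) (by omega) _ hl
  have key : corr x (p + 1) (q + 2) - 1 / 2 * corr x (p + 1) (q + 1) - 1 / 2 * corr x p q = 0 := by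
    have : corr x (p + 1) (q + 2) - 1 / 2 * corr x (p + 1) (q + 1) - 1 / 2 * corr x p q =
        -(avg fun u => sgn (cell x u p (q + 1)) * (emp (cell x u p q) * sgn (u x))) +
        1 / 2 * (avg fun u => sgn (cell x u p (q + 1 + 1)) * (emp (cell x u p (q + 1)) *
          (sgn (u x) * (1 + sgn (nextColumn (u (x + (p + 1 : ℕ))) (cell x u p) (q + 1)))))) -
        (avg fun u => sgn (cell x u p (q + 2)) *
          (occ (cell x u p (q + 1)) * occ (cell x u p q) * sgn (u x))) := by
      simp only [corr, ← avg_const_mul, ← avg_sub, ← avg_neg, ← avg_add]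
      congr 1
      funext u
      have h := congrArg (fun r => sgn (u x) * r) (spin_identity (cell x u p q)
        (cell x u p (q + 1)) (cell x u p (q + 2)) (cell x u (p + 1) q))
      rw [← cell_succ_succ, ← cell_succ_succ] at h
      rw [← cell_succ_eq_nextColumn]
      linear_combination h
    rw [this, h1, h2, h3]
    simp
  linarith

/-- Reflecting the ring about `x` exchanges the two light rays. -/
theorem corr_comm (x : ZMod n) (p q : ℕ) : corr x p q = corr x q p := by
  have hinv : Function.Involutive (fun u : Config n => fun y => u (x + x - y)) := by
    intro u; funext y; simp
  have h := avg_comp hinv.toPerm (fun u => sgn (u x) * sgn (cell x u p q))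
  simp only [Function.Involutive.coe_toPerm, cell_reflect] at h
  rw [corr, corr, ← h]
  simp

theorem corr_zero_zero (x : ZMod n) : corr x 0 0 = 1 := by
  have : ∀ a : ZMod 2, sgn a * sgn a = 1 := by
    intro a; rcases zmod_two_cases a with rfl | rfl <;> simp
  simp [corr, cell_zero, this, avg_const]

theorem avg_sgn_mul_sgn {x y : ZMod n} (h : y ≠ x) :
    avg (fun u : Config n => sgn (u x) * sgn (u y)) = 0 := by
  have := avg_sgn_mul_eq_zero (n := n) y (fun u => sgn (u x)) fun u b => by
    rw [Function.update_of_ne h.symm]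
  rw [← this]
  congr 1
  funext u
  ring

theorem corr_zero_left (x : ZMod n) {q : ℕ} (h0 : 1 ≤ q) (h : q < n) : corr x 0 q = 0 := by
  simp only [corr, cell_zero]
  exact avg_sgn_mul_sgn (sub_natCast_ne_self h0 h)

theorem corr_one_one (x : ZMod n) (h : 2 < n) : corr x 1 1 = -1 / 2 := by
  have h1 : x - (1 : ℕ) ≠ x := sub_natCast_ne_self le_rfl (by omega)
  have h2 : x - (1 : ℕ) ≠ x + (1 : ℕ) := sub_natCast_ne_add_natCast le_rfl (by omega)
  have h3 : x + (1 : ℕ) ≠ x := fun h' => sub_natCast_ne_self (x := x) le_rfl (by omega : 1 < n)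
    (by linear_combination -h')
  have e : ∀ u : Config n, sgn (u x) * sgn (cell x u 1 1) = -(1 / 2 : ℝ) +
      1 / 2 * (sgn (u (x + (1 : ℕ))) * 1) +
      1 / 2 * (sgn (u (x - (1 : ℕ))) * (1 + sgn (u (x + (1 : ℕ))))) := by
    intro u
    rw [cell_succ_succ, cell_zero, cell_zero, cell_succ_zero]
    rw [Nat.zero_add, Nat.cast_zero, sub_zero]
    generalize u (x + (1 : ℕ)) = a
    generalize u (x - (1 : ℕ)) = b
    generalize u x = c
    rcases zmod_two_cases a with rfl | rfl <;> rcases zmod_two_cases b with rfl | rfl <;>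
      rcases zmod_two_cases c with rfl | rfl <;> simp [chi, zmod_two_one_add_one] <;> norm_num
  simp only [corr, e, avg_add, avg_const_mul, avg_const]
  rw [avg_sgn_mul_eq_zero _ (fun _ => 1) (fun _ _ => rfl), avg_sgn_mul_eq_zero _
    (fun u : Config n => 1 + sgn (u (x + ((1 : ℕ) : ZMod n)))) (fun u b => by rw [Function.update_of_ne h2.symm])]
  norm_num

end Correlation

/-! ### From the initial configuration to data on the light rays -/

/-- The distance of two sites on the ring. -/
def ringDist {n : ℕ} (x j : ZMod n) : ℕ := (j - x).valMinAbs.natAbs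

open Classical in
/-- The update of the sites of one parity class that lie in the set `m`. -/
noncomputable def maskedUpdate (n par : ℕ) (m : Set (ZMod n)) (s : Config n) : Config n := fun j =>
  if j.val % 2 = par % 2 ∧ j ∈ m then chi (s (j - 1)) (s j) (s (j + 1)) else s j

/-- The state after `τ` of the `T` updates that make up the evolution of an observable. -/
def traj (n T : ℕ) : ℕ → Config n → Config n
  | 0, s => s
  | τ + 1, s => update n (T + 1 + τ) (traj n T τ s)

/-- The evolution in which a site is frozen as soon as the forward light cone of `x` reaches it. -/
noncomputable def frozen {n : ℕ} (x : ZMod n) (T : ℕ) : ℕ → Config n → Config n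
  | 0, s => s
  | τ + 1, s => maskedUpdate n (T + 1 + τ) {j | τ + 1 ≤ ringDist x j} (frozen x T τ s)

theorem update_congr {n a b : ℕ} (h : a % 2 = b % 2) : update n a = update n b := by
  funext s j
  simp only [update, h]

theorem maskedUpdate_univ (n par : ℕ) (s : Config n) :
    maskedUpdate n par Set.univ s = update n par s := by
  funext j
  simp [maskedUpdate, update]

theorem chi_chi (a b c : ZMod 2) : chi a (chi a b c) c = b := by revert a b c; decide

/-- An observable evolved for T steps sees the updates with parities T - 1, ..., 0 in this order; `T
+ 1 + τ` has the parity of T - 1 - τ and avoids truncated subtraction. -/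
theorem traj_shift {n T : ℕ} (τ : ℕ) (s : Config n) :
    traj n (T + 1) (τ + 1) s = traj n T τ (update n T s) := by
  induction τ with
  | zero => exact congrFun (update_congr (show (T + 1 + 1 + 0) % 2 = T % 2 by omega)) s
  | succ τ ih =>
    rw [traj, ih, traj, update_congr
      (show (T + 1 + 1 + (τ + 1)) % 2 = (T + 1 + τ) % 2 by omega)]

theorem evolve_eq_traj {n : ℕ} (a : Observable n) (T : ℕ) (s : Config n) :
    evolve a T s = a (traj n T T s) := by
  induction T generalizing s with
  | zero => rfl
  | succ T ih => rw [traj_shift, ← ih]; rfl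

theorem density_eq {n : ℕ} (x : ℤ) (s : Config n) :
    density n x s = 1 / 2 - 1 / 2 * sgn (s (x : ZMod n)) := by
  rw [density]
  rcases zmod_two_cases (s (x : ZMod n)) with h | h <;> rw [h] <;> norm_num

theorem castHom_intCast_of_even {n : ℕ} (hn : 2 ∣ n) {x : ℤ} {T : ℕ} (h : Even (x + T)) :
    ZMod.castHom hn (ZMod 2) (x : ZMod n) = T := by
  rw [map_intCast]
  have h2 : ((x + T : ℤ) : ZMod 2) = 0 := by
    rw [ZMod.intCast_zmod_eq_zero_iff_dvd]
    exact_mod_cast even_iff_two_dvd.1 h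
  push_cast at h2
  rw [eq_neg_of_add_eq_zero_left h2]
  exact CharTwo.neg_eq _

section EvenRing

variable {n : ℕ} [NeZero n]

theorem val_parity_iff (hn : 2 ∣ n) (j : ZMod n) (k : ℕ) :
    j.val % 2 = k % 2 ↔ ZMod.castHom hn (ZMod 2) j = k := by
  rw [← ZMod.natCast_eq_natCast_iff', ZMod.castHom_apply, ZMod.natCast_val]

/-- On an even ring the neighbours of an updated site have the other parity and stay put, so
applying the local rule twice undoes it, whatever the mask. -/
theorem maskedUpdate_involutive (hn : 2 ∣ n) (par : ℕ) (m : Set (ZMod n)) :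
    Function.Involutive (maskedUpdate n par m) := by
  have hpar : ∀ j : ZMod n, j.val % 2 = par % 2 →
      ¬ (j - 1).val % 2 = par % 2 ∧ ¬ (j + 1).val % 2 = par % 2 := by
    intro j
    simp only [val_parity_iff hn, map_sub, map_add, map_one]
    generalize ZMod.castHom hn (ZMod 2) j = a
    generalize (par : ZMod 2) = b
    revert a b; decide
  intro s
  funext j
  by_cases hj : j.val % 2 = par % 2 ∧ j ∈ m
  · obtain ⟨h1, h2⟩ := hpar j hj.1
    simp only [maskedUpdate, hj, h1, h2, false_and, if_false, and_self, if_true, chi_chi]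
  · simp only [maskedUpdate, hj, if_false]

theorem update_involutive (hn : 2 ∣ n) (par : ℕ) : Function.Involutive (update n par) := by
  intro s
  rw [← maskedUpdate_univ, ← maskedUpdate_univ]
  exact maskedUpdate_involutive hn par _ s

theorem traj_bijective (hn : 2 ∣ n) (T τ : ℕ) : Function.Bijective (traj n T τ) := by
  induction τ with
  | zero => exact Function.bijective_id
  | succ τ ih => exact (update_involutive hn _).bijective.comp ih

theorem frozen_bijective (hn : 2 ∣ n) (x : ZMod n) (T τ : ℕ) : Function.Bijective (frozen x T τ) := by
  induction τ with
  | zero => exact Function.bijective_id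
  | succ τ ih => exact (maskedUpdate_involutive hn _ _).bijective.comp ih

theorem ringDist_add_natCast (hn : 2 ∣ n) (x : ZMod n) {i : ℕ} (hi : 2 * i ≤ n) :
    ringDist x (x + i) = i := by
  rw [ringDist, add_sub_cancel_left, (ZMod.valMinAbs_spec _ (i : ℤ)).2]
  · simp
  · have := NeZero.pos n
    exact ⟨by simp, by constructor <;> omega⟩

theorem ringDist_sub_natCast (hn : 2 ∣ n) (x : ZMod n) {i : ℕ} (hi : 2 * i ≤ n) :
    ringDist x (x - i) = i := by
  have h := ringDist_add_natCast hn x hi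
  rw [ringDist, add_sub_cancel_left] at h
  rw [ringDist, sub_sub_cancel_left, ZMod.natAbs_valMinAbs_neg, h]

theorem ringDist_triangle (hn : 2 ∣ n) (x j : ZMod n) :
    ringDist x j ≤ ringDist x (j - 1) + 1 ∧ ringDist x j ≤ ringDist x (j + 1) + 1 := by
  have h1 : (1 : ZMod n).valMinAbs.natAbs = 1 := by
    have := ringDist_add_natCast hn (0 : ZMod n) (i := 1) (by have := NeZero.pos n; omega)
    simpa [ringDist] using this
  constructor
  · have h := ZMod.natAbs_valMinAbs_add_le (j - 1 - x) 1
    rw [show j - 1 - x + 1 = j - x by ring] at h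
    exact h.trans ((Int.natAbs_add_le _ _).trans (by rw [h1, ringDist]))
  · have h := ZMod.natAbs_valMinAbs_add_le (j + 1 - x) (-1)
    rw [show j + 1 - x + -1 = j - x by ring] at h
    exact h.trans ((Int.natAbs_add_le _ _).trans (by rw [ZMod.natAbs_valMinAbs_neg, h1, ringDist]))

/-- A site that is still active at step τ + 1 has neighbours at distance at least τ from `x`. These
have not been frozen before time τ, so the site is updated from the true values. -/
theorem frozen_eq_traj (hn : 2 ∣ n) (x : ZMod n) (T τ : ℕ) (s : Config n) (j : ZMod n) :
    frozen x T τ s j = traj n T (min τ (ringDist x j)) s j := by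
  induction τ generalizing j with
  | zero => simp [frozen, traj]
  | succ τ ih =>
    obtain ⟨h1, h2⟩ := ringDist_triangle hn x j
    rw [frozen, maskedUpdate]
    by_cases hd : τ + 1 ≤ ringDist x j
    · rw [min_eq_left hd, traj, update, ih, ih, ih, min_eq_left (by omega : τ ≤ ringDist x j),
        min_eq_left (by omega : τ ≤ ringDist x (j - 1)),
        min_eq_left (by omega : τ ≤ ringDist x (j + 1))]
      simp only [Set.mem_ofPred_eq, hd, and_true]
    · rw [min_eq_right (by omega : ringDist x j ≤ τ + 1), if_neg (fun h => hd h.2), ih,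
        min_eq_right (by omega)]

theorem traj_eq_cell (hn : 2 ∣ n) {x : ZMod n} {T : ℕ} (hx : ZMod.castHom hn (ZMod 2) x = T) (hT : 2 * T ≤ n)
    (s : Config n) (i k : ℕ) (hik : i + k ≤ T) :
    traj n T (i + k) s (x + i - k) = cell x (frozen x T T s) i k := by
  induction i generalizing k with
  | zero =>
    rw [cell_zero, frozen_eq_traj hn, ringDist_sub_natCast hn _ (by omega),
      min_eq_right (by omega)]
    simp
  | succ i ihi =>
    induction k with
    | zero =>
      rw [cell_succ_zero, frozen_eq_traj hn, ringDist_add_natCast hn _ (by omega),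
        min_eq_right (by omega)]
      simp
    | succ k ihk =>
      have hp : ∀ τ : ℕ, (x + (i + 1 : ℕ) - (k + 1 : ℕ)).val % 2 = (T + 1 + τ) % 2 ↔
          ((i + k : ℕ) : ZMod 2) = (1 + τ : ℕ) := by
        intro τ
        rw [val_parity_iff hn]
        simp only [map_sub, map_add, map_natCast, hx]
        push_cast
        generalize (T : ZMod 2) = a
        generalize (i : ZMod 2) = b
        generalize (k : ZMod 2) = c
        generalize (τ : ZMod 2) = d
        revert a b c d; decide
      have e1 := ihi (k + 1) (by omega)
      have e2 := ihi k (by omega)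
      have e3 := ihk (by omega)
      rw [cell_succ_succ, ← e1, ← e2, ← e3,
        show i + 1 + (k + 1) = (i + k + 1) + 1 by ring, traj, update, if_pos]
      · rw [show i + (k + 1) = i + k + 1 by ring, show i + 1 + k = i + k + 1 by ring]
        congr 1
        · congr 1; push_cast; ring
        -- The middle argument of the rule is the same site one step earlier; parity shows that this
        -- site was idle in the preceding step, so its value is that of the cell (i, k).
        · rw [traj, update, if_neg]
          · congr 1; push_cast; ring
          · rw [hp]
            push_cast
            generalize (i : ZMod 2) = b
            generalize (k : ZMod 2) = c
            revert b c; decide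
        · congr 1; push_cast; ring
      · rw [hp]
        push_cast
        generalize (i : ZMod 2) = b
        generalize (k : ZMod 2) = c
        revert b c; decide

theorem expval_maxEntropy (a : Observable n) : expval (maxEntropy n) a = avg a := by
  simp only [expval, maxEntropy, avg, Finset.sum_div, mul_one_div]

theorem avg_comp_bijective {e : Config n → Config n} (he : Function.Bijective e)
    (f : Config n → ℝ) : avg (fun u => f (e u)) = avg f :=
  avg_comp (Equiv.ofBijective e he) f

theorem avg_sgn (y : ZMod n) : avg (fun u : Config n => sgn (u y)) = 0 := by
  simpa using avg_sgn_mul_eq_zero (n := n) y (fun _ => 1) (fun _ _ => rfl)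

/-- Each density is (1 - spin)/2 and single spins average to zero, at time `T` because the dynamics
is a bijection. -/
theorem structureFactor_eq_avg (hn : 2 ∣ n) (x : ℤ) (T : ℕ) :
    structureFactor n x T = 1 / 4 * avg (fun s => sgn (s (x : ZMod n)) * sgn (traj n T T s 0)) := by
  have h0 := avg_comp_bijective (traj_bijective hn T T) (fun u => sgn (u 0))
  rw [avg_sgn] at h0
  have e : ∀ s : Config n, evolve (density n 0) T s * density n x s = 1 / 4 -
      1 / 4 * sgn (s (x : ZMod n)) - 1 / 4 * sgn (traj n T T s 0) +
      1 / 4 * (sgn (s (x : ZMod n)) * sgn (traj n T T s 0)) := by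
    intro s
    rw [evolve_eq_traj, density_eq, density_eq, Int.cast_zero]
    ring
  have e' : ∀ s : Config n, density n 0 s = 1 / 2 - 1 / 2 * sgn (s 0) := by
    intro s
    rw [density_eq, Int.cast_zero]
  rw [structureFactor, expval_maxEntropy, expval_maxEntropy]
  simp only [e, avg_add, avg_sub, avg_const_mul, avg_const, h0, avg_sgn]
  rw [show density n 0 = fun s => 1 / 2 - 1 / 2 * sgn (s 0) from funext e']
  simp only [avg_sub, avg_const_mul, avg_const, avg_sgn]
  norm_num

/-- The extra update acts on the configuration first and leaves the site `x` alone, since `x` and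
`t` have opposite parity. It is therefore absorbed by a change of variables. -/
theorem structureFactor_add_one (hn : 2 ∣ n) (x : ℤ) (t : ℕ) (hx : Odd (x + t)) :
    structureFactor n x (t + 1) = structureFactor n x t := by
  rw [structureFactor_eq_avg hn, structureFactor_eq_avg hn,
    ← avg_comp_bijective (update_involutive hn t).bijective
      (fun s => sgn (s (x : ZMod n)) * sgn (traj n t t s 0))]
  congr 2
  funext s
  rw [traj_shift, update, if_neg]
  rw [val_parity_iff hn, map_intCast]
  intro h
  have h2 : ((x + t : ℤ) : ZMod 2) = 0 := by
    push_cast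
    rw [h]
    exact CharTwo.add_self_eq_zero _
  rw [ZMod.intCast_zmod_eq_zero_iff_dvd] at h2
  exact (Int.not_even_iff_odd.2 hx) (even_iff_two_dvd.2 (by exact_mod_cast h2))

theorem frozen_self (hn : 2 ∣ n) (x : ZMod n) (T : ℕ) (s : Config n) : frozen x T T s x = s x := by
  rw [frozen_eq_traj hn, show ringDist x x = 0 by simp [ringDist], Nat.min_zero, traj]

/-- Inside of the light cone, the structure factor is the correlation of two opposite corners. -/
theorem structureFactor_eq_corr (hn : 2 ∣ n) (p q : ℕ) (h : 2 * (p + q) ≤ n) :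
    structureFactor n ((q : ℤ) - p) (p + q) = 1 / 4 * corr (((q : ℤ) - p : ℤ) : ZMod n) p q := by
  have hx := castHom_intCast_of_even hn (x := (q : ℤ) - p) (T := p + q)
    (by push_cast; exact ⟨q, by ring⟩)
  rw [structureFactor_eq_avg hn, corr]
  conv_rhs => rw [← avg_comp_bijective
    (frozen_bijective hn (((q : ℤ) - p : ℤ) : ZMod n) (p + q) (p + q))]
  congr 2
  funext s
  rw [← traj_eq_cell hn hx h s p q le_rfl, frozen_self hn]
  congr 3
  push_cast
  ring

/-- Outside of the light cone, the structure factor vanishes. -/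
theorem structureFactor_eq_zero (hn : 2 ∣ n) (x : ℤ) (T : ℕ) (h1 : -(n : ℤ) < 2 * x)
    (h2 : 2 * x ≤ n) (h : (T : ℤ) ≤ |x|) (h0 : x ≠ 0) : structureFactor n x T = 0 := by
  have hd : ringDist (x : ZMod n) 0 = x.natAbs := by
    rw [ringDist, zero_sub, ZMod.natAbs_valMinAbs_neg, (ZMod.valMinAbs_spec _ x).2]
    exact ⟨rfl, by constructor <;> omega⟩
  have hT : T ≤ x.natAbs := by rw [Int.abs_eq_natAbs] at h; omega
  rw [structureFactor_eq_avg hn]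
  have e : ∀ s : Config n, sgn (s (x : ZMod n)) * sgn (traj n T T s 0) =
      sgn (frozen (x : ZMod n) T T s x) * sgn (frozen (x : ZMod n) T T s 0) := by
    intro s
    rw [frozen_self hn, frozen_eq_traj hn _ _ _ _ 0, hd, min_eq_left hT]
  simp only [e]
  rw [avg_comp_bijective (frozen_bijective hn _ T T)
    (fun s => sgn (s (x : ZMod n)) * sgn (s 0)), avg_sgn_mul_sgn, mul_zero]
  intro h'
  rw [← h'] at hd
  simp [ringDist] at hd
  omega

end EvenRing

/-! ### The closed form solves the recurrence -/

/-- The summands of the closed form, including the prefactor. -/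
noncomputable def summand (m t : ℕ) : ℝ :=
  (1 / 2) ^ (t + 1) * (4 ^ m * (2 * binom ((t : ℤ) - 2 * m - 3) m - binom ((t : ℤ) - 2 * m - 2) m))

/-- The closed form as a function of the number of summands. -/
noncomputable def partialForm (M t : ℕ) : ℝ := ∑ m ∈ Finset.range M, summand m t

/-- The source term of the recurrence in time. -/
noncomputable def source (m t : ℕ) : ℝ := (1 / 2) ^ (t + 1) * (4 ^ m * binom ((t : ℤ) - 2 * m - 3) m)

theorem closedForm_eq (x : ℤ) (t : ℕ) :
    closedForm x t = partialForm (((t : ℤ) - |x|) / 2).toNat t := by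
  rw [closedForm, partialForm, Finset.mul_sum,
    show ((t : ℤ) - |x| - 2) / 2 + 1 = ((t : ℤ) - |x|) / 2 by omega]
  refine Finset.sum_congr rfl fun m _ => ?_
  rw [summand, show -(t : ℤ) - 1 = -((t + 1 : ℕ) : ℤ) by push_cast; ring, zpow_neg, zpow_natCast,
    one_div, inv_pow]

theorem binom_succ_succ (k : ℤ) (m : ℕ) : binom (k + 1) (m + 1) = binom k (m + 1) + binom k m := by
  rcases lt_trichotomy k (-1) with h | rfl | h
  · simp [binom, show k < 0 by omega, show k + 1 < 0 by omega]
  · simp [binom]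
  · obtain ⟨j, rfl⟩ := Int.eq_ofNat_of_zero_le (by omega : 0 ≤ k)
    have h1 : ¬ ((j : ℤ) < 0) := by omega
    have h2 : ¬ ((j : ℤ) + 1 < 0) := by omega
    simp only [binom, h1, h2, if_false]
    rw [show ((j : ℤ) + 1).toNat = j + 1 by omega, show (j : ℤ).toNat = j by omega,
      Nat.choose_succ_succ]
    push_cast
    ring

theorem binom_zero_right {k : ℤ} (h : 0 ≤ k) : binom k 0 = 1 := by
  simp [binom, not_lt.2 h]

theorem binom_of_neg {k : ℤ} (h : k < 0) (m : ℕ) : binom k m = 0 := by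
  simp [binom, h]

theorem binom_of_lt {k : ℤ} {m : ℕ} (h : k < m) : binom k m = 0 := by
  by_cases hk : k < 0
  · exact binom_of_neg hk m
  · simp only [binom, hk, if_false]
    rw [Nat.choose_eq_zero_of_lt (by omega), Nat.cast_zero]

theorem summand_eq_zero {m t : ℕ} (h : t < 3 * m + 2) : summand m t = 0 := by
  rw [summand, binom_of_lt (by omega), binom_of_lt (by omega)]
  simp

theorem source_eq_zero {m t : ℕ} (h : t < 3 * m + 3) : source m t = 0 := by
  rw [source, binom_of_lt (by omega)]
  simp

theorem source_eq {m t N : ℕ} (h : t = N + 2 * m + 3) :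
    source m t = 1 / 16 * (N.choose m / 2 ^ N) := by
  subst h
  rw [source, binom, if_neg (by push_cast; omega),
    show (((N + 2 * m + 3 : ℕ) : ℤ) - 2 * m - 3).toNat = N by push_cast; omega]
  rw [show N + 2 * m + 3 + 1 = N + 2 * m + 4 by ring, pow_add, pow_add, pow_mul]
  rw [show (4 : ℝ) ^ m = ((1 / 2 : ℝ) ^ 2)⁻¹ ^ m by norm_num, inv_pow, one_div, inv_pow]
  field_simp
  ring

/-- Pascal's rule for each of the two binomials; the power 4^m and the prefactor supply the halves.
-/
theorem summand_succ_step (m t : ℕ) :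
    summand (m + 1) (t + 3) = 1 / 2 * summand (m + 1) (t + 2) + 1 / 2 * summand m t := by
  have h1 := binom_succ_succ ((t : ℤ) - 2 * m - 3) m
  have h2 := binom_succ_succ ((t : ℤ) - 2 * m - 2) m
  have e1 : (t : ℤ) - 2 * m - 3 + 1 = t - 2 * m - 2 := by ring
  have e2 : (t : ℤ) - 2 * m - 2 + 1 = t - 2 * m - 1 := by ring
  rw [e1] at h1
  rw [e2] at h2
  simp only [summand]
  push_cast
  rw [show (t : ℤ) + 3 - 2 * (m + 1) - 3 = t - 2 * m - 2 by ring,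
    show (t : ℤ) + 3 - 2 * (m + 1) - 2 = t - 2 * m - 1 by ring,
    show (t : ℤ) + 2 - 2 * (m + 1) - 3 = t - 2 * m - 3 by ring,
    show (t : ℤ) + 2 - 2 * (m + 1) - 2 = t - 2 * m - 2 by ring, h2, h1]
  ring

theorem summand_zero {t : ℕ} (h : 3 ≤ t) : summand 0 t = (1 / 2) ^ (t + 1) := by
  rw [summand, binom_zero_right (by push_cast; omega), binom_zero_right (by push_cast; omega)]
  norm_num

theorem summand_zero_two : summand 0 2 = -1 / 8 := by
  rw [summand, binom_of_neg (by norm_num), binom_zero_right (by norm_num)]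
  norm_num

theorem partialForm_step (M : ℕ) {t : ℕ} (ht : 1 ≤ t) :
    partialForm (M + 1) (t + 3) =
      1 / 2 * partialForm (M + 1) (t + 2) + 1 / 2 * partialForm M t := by
  simp only [partialForm]
  rw [Finset.sum_range_succ', Finset.sum_range_succ' _ M]
  simp only [summand_succ_step, Finset.sum_add_distrib, ← Finset.mul_sum]
  rw [summand_zero (by omega), summand_zero (by omega)]
  ring

/-- Allows one superfluous summand, as needed when the recurrence crosses the diagonal p = q. -/
theorem partialForm_succ_of_lt {M t : ℕ} (h : t < 3 * M + 2) :
    partialForm (M + 1) t = partialForm M t := by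
  rw [partialForm, Finset.sum_range_succ, summand_eq_zero h, add_zero, partialForm]

theorem partialForm_eq_of_lt {M t : ℕ} (h : t < 5) :
    partialForm (M + 1) t = summand 0 t := by
  induction M with
  | zero => simp [partialForm]
  | succ M ih => rw [partialForm_succ_of_lt (by omega), ih]

/-- Induction on the time p + q. When the recurrence leads to a cell with p > q, reflection brings
it back to p ≤ q, at the price of a summand that vanishes. The corner and the cell (1, 1) are
computed by hand, because the closed form does not describe the corner. -/
theorem corr_eq_partialForm {n : ℕ} [NeZero n] (x : ZMod n) (p q : ℕ) (hpq : p ≤ q) (hq : 1 ≤ q)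
    (hn : p + q < n) : corr x p q = 4 * partialForm p (p + q) := by
  induction h : p + q using Nat.strong_induction_on generalizing p q with
  | _ N ih =>
    subst h
    rcases p with _ | p
    · rw [corr_zero_left x hq (by omega)]
      simp [partialForm]
    · obtain ⟨q, rfl⟩ : ∃ r, q = r + 1 := ⟨q - 1, by omega⟩
      rcases q with _ | q
      · obtain rfl : p = 0 := by omega
        rw [corr_one_one x (by omega), partialForm_eq_of_lt (by norm_num), summand_zero_two]
        norm_num
      · rw [corr_succ_succ x (by omega) (by omega)]
        have h1 : corr x (p + 1) (q + 1) = 4 * partialForm (p + 1) (p + q + 2) := by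
          rcases Nat.lt_or_ge q p with hlt | hle
          · obtain rfl : p = q + 1 := by omega
            rw [corr_comm, ih (q + 1 + (q + 1 + 1)) (by omega) (q + 1) (q + 1 + 1) (by omega)
              (by omega) (by omega) rfl, partialForm_succ_of_lt (M := q + 1) (by omega)]
            congr 2
          · rw [ih (p + 1 + (q + 1)) (by omega) (p + 1) (q + 1) (by omega) (by omega) (by omega)
              rfl]
            congr 2
            ring
        rw [h1, show p + 1 + (q + 1 + 1) = p + q + 3 by ring]
        rcases Nat.eq_zero_or_pos (p + q) with h0 | h0
        · obtain ⟨rfl, rfl⟩ : p = 0 ∧ q = 0 := by omega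
          rw [corr_zero_zero, partialForm_eq_of_lt (by norm_num), partialForm_eq_of_lt (by norm_num),
            summand_zero_two, summand_zero (by norm_num)]
          norm_num
        · rw [partialForm_step p h0]
          have h2 : corr x p q = 4 * partialForm p (p + q) := by
            rcases Nat.lt_or_ge q p with hlt | hle
            · obtain rfl : p = q + 1 := by omega
              rw [corr_comm, ih (q + (q + 1)) (by omega) q (q + 1) (by omega)
                (by omega) (by omega) rfl, partialForm_succ_of_lt (M := q) (by omega)]
              congr 2
              ring
            · exact ih (p + q) (by omega) p q (by omega) (by omega) (by omega) rfl
          rw [h2]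
          ring

theorem structureFactor_eq_partialForm {n : ℕ} [NeZero n] (hn : Even n) (x : ℤ) (T : ℕ)
    (hT : 2 * T ≤ n) (hxT : Even (x + T)) (h1 : -(n : ℤ) < 2 * x) (h2 : 2 * x ≤ n)
    (h0 : ¬ (x = 0 ∧ T = 0)) :
    structureFactor n x T = partialForm (((T : ℤ) - |x|) / 2).toNat T := by
  have hn2 : 2 ∣ n := even_iff_two_dvd.1 hn
  by_cases h : (T : ℤ) ≤ |x|
  · rw [structureFactor_eq_zero hn2 x T h1 h2 h, show (((T : ℤ) - |x|) / 2).toNat = 0 by omega]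
    · simp [partialForm]
    · rintro rfl
      simp at h
      exact h0 ⟨rfl, h⟩
  · obtain ⟨k, hk⟩ := hxT
    have hx1 := le_abs_self x
    have hx2 := neg_abs_le x
    obtain ⟨q, hq⟩ := Int.eq_ofNat_of_zero_le (by omega : 0 ≤ k)
    obtain ⟨p, hp⟩ := Int.eq_ofNat_of_zero_le (by omega : 0 ≤ T - k)
    obtain rfl : x = (q : ℤ) - p := by omega
    obtain rfl : T = p + q := by omega
    rw [structureFactor_eq_corr hn2 p q hT]
    rcases le_total p q with hpq | hpq
    · rw [corr_eq_partialForm _ p q hpq (by omega) (by omega),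
        abs_of_nonneg (by omega), show ((((p + q : ℕ) : ℤ) - (q - p)) / 2).toNat = p by omega]
      ring
    · rw [corr_comm, corr_eq_partialForm _ q p hpq (by omega) (by omega),
        abs_of_nonpos (by omega), show ((((p + q : ℕ) : ℤ) - -((q : ℤ) - p)) / 2).toNat = q by omega,
        add_comm q p]
      ring

/-! ### The damped recurrence in time -/

/-- The solution of `a (t + 2) = - (a (t + 1) + a t) / 2` with given initial values. -/
noncomputable def damped (a b : ℝ) : ℕ → ℝ
  | 0 => a
  | 1 => b
  | t + 2 => -(1 / 2) * damped a b (t + 1) - 1 / 2 * damped a b t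

/-- The closed form with `M + 1` summands, with the value at time zero that makes the recurrence in
time hold from the start. -/
noncomputable def profile (M t : ℕ) : ℝ := if t = 0 then 1 / 4 else partialForm (M + 1) t

theorem damped_add_two (a b : ℝ) (t : ℕ) :
    damped a b (t + 2) = -(1 / 2) * damped a b (t + 1) - 1 / 2 * damped a b t := by
  rw [damped]

/-- The right-hand side telescopes in `m`, so that in `partialForm_time_step` only the last source
term survives. -/
theorem summand_time_step (m t : ℕ) :
    summand (m + 1) (t + 2) + 1 / 2 * summand (m + 1) (t + 1) + 1 / 2 * summand (m + 1) t =
      source (m + 1) t - source m t := by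
  have h := binom_succ_succ ((t : ℤ) - 2 * m - 3) m
  rw [show (t : ℤ) - 2 * m - 3 + 1 = t - 2 * m - 2 by ring] at h
  simp only [summand, source]
  push_cast
  rw [show (t : ℤ) + 2 - 2 * (m + 1) - 3 = t - 2 * m - 3 by ring,
    show (t : ℤ) + 2 - 2 * (m + 1) - 2 = t - 2 * m - 2 by ring,
    show (t : ℤ) + 1 - 2 * (m + 1) - 3 = t - 2 * m - 4 by ring,
    show (t : ℤ) + 1 - 2 * (m + 1) - 2 = t - 2 * m - 3 by ring,
    show (t : ℤ) - 2 * (m + 1) - 3 = t - 2 * m - 5 by ring,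
    show (t : ℤ) - 2 * (m + 1) - 2 = t - 2 * m - 4 by ring, h]
  ring

theorem summand_zero_time_step {t : ℕ} (ht : 1 ≤ t) :
    summand 0 (t + 2) + 1 / 2 * summand 0 (t + 1) + 1 / 2 * summand 0 t = source 0 t := by
  obtain rfl | rfl | h : t = 1 ∨ t = 2 ∨ 3 ≤ t := by omega
  · rw [source_eq_zero (by norm_num), summand_zero (by norm_num), summand_zero_two,
      summand_eq_zero (by norm_num)]
    norm_num
  · rw [source_eq_zero (by norm_num), summand_zero (by norm_num), summand_zero (by norm_num),
      summand_zero_two]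
    norm_num
  · rw [summand_zero h, summand_zero (by omega), summand_zero (by omega), source,
      binom_zero_right (by push_cast; omega)]
    ring

theorem partialForm_time_step (M : ℕ) {t : ℕ} (ht : 1 ≤ t) :
    partialForm (M + 1) (t + 2) + 1 / 2 * partialForm (M + 1) (t + 1) +
      1 / 2 * partialForm (M + 1) t = source M t := by
  induction M with
  | zero => simpa [partialForm] using summand_zero_time_step ht
  | succ M ih =>
    have h := summand_time_step M t
    have e : ∀ s, partialForm (M + 1 + 1) s = partialForm (M + 1) s + summand (M + 1) s :=
      fun s => Finset.sum_range_succ _ _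
    rw [e, e, e]
    linear_combination ih + h

theorem profile_add_two (M t : ℕ) : profile M (t + 2) =
    -(1 / 2) * profile M (t + 1) - 1 / 2 * profile M t + source M t := by
  rcases Nat.eq_zero_or_pos t with rfl | ht
  · simp only [profile]
    norm_num
    rw [partialForm_eq_of_lt (by norm_num), partialForm_eq_of_lt (by norm_num), summand_zero_two,
      summand_eq_zero (by norm_num), source_eq_zero (by omega)]
    norm_num
  · have h := partialForm_time_step M ht
    simp only [profile, show t ≠ 0 by omega, if_false, Nat.add_eq_zero_iff, and_false,
      OfNat.ofNat_ne_zero, one_ne_zero]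
    linarith

theorem profile_one (M : ℕ) : profile M 1 = 0 := by
  rw [profile, if_neg one_ne_zero, partialForm_eq_of_lt (by norm_num), summand_eq_zero (by norm_num)]

theorem profile_zero (M : ℕ) : profile M 0 = 1 / 4 := by simp [profile]

/-- Duhamel's formula for the recurrence in time. -/
theorem profile_eq_sum (M t : ℕ) : profile M (t + 2) = damped (1 / 4) 0 (t + 2) +
    ∑ k ∈ Finset.range (t + 1), damped 1 (-(1 / 2)) k * source M (t - k) := by
  induction t using Nat.twoStepInduction with
  | zero =>
    rw [profile_add_two, profile_one, profile_zero]
    simp [damped]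
  | one =>
    rw [profile_add_two, profile_add_two, profile_one, profile_zero]
    simp [damped, Finset.sum_range_succ]
    ring
  | more t ih1 ih2 =>
    rw [profile_add_two, ih1, ih2, damped_add_two _ _ (t + 2)]
    rw [Finset.sum_range_succ' _ (t + 2), Finset.sum_range_succ' _ (t + 1),
      Finset.sum_range_succ' _ (t + 1)]
    simp only [damped_add_two 1, sub_mul, Finset.sum_sub_distrib, mul_assoc, ← Finset.mul_sum,
      Nat.zero_add, Nat.sub_zero]
    have e1 : ∀ k, t + 2 - (k + 1 + 1) = t - k := fun k => by omega
    have e2 : ∀ k, t + 1 - (k + 1) = t - k := fun k => by omega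
    simp only [e1, e2, damped]
    rw [show t + 2 - 1 = t + 1 by omega]
    ring

/-- In the central part of the light cone, the closed form does not depend on the position. -/
theorem profile_eq_damped {M t : ℕ} (h : t < 3 * M + 5) : profile M t = damped (1 / 4) 0 t := by
  match t, h with
  | 0, _ => rw [profile_zero, damped]
  | 1, _ => rw [profile_one, damped]
  | t + 2, h =>
    rw [profile_eq_sum, Finset.sum_eq_zero, add_zero]
    intro k _
    rw [source_eq_zero (by omega), mul_zero]

/-- This quadratic form is the one attached to the characteristic polynomial z² + z/2 + 1/2; each
step multiplies it by the product 1/2 of the roots. -/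
theorem damped_energy (a b : ℝ) (t : ℕ) :
    damped a b (t + 1) ^ 2 + 1 / 2 * damped a b (t + 1) * damped a b t +
      1 / 2 * damped a b t ^ 2 = (1 / 2) ^ t * (b ^ 2 + 1 / 2 * b * a + 1 / 2 * a ^ 2) := by
  induction t with
  | zero => simp [damped]
  | succ t ih =>
    rw [damped_add_two, pow_succ]
    linear_combination 1 / 2 * ih

theorem damped_sq_le (a b : ℝ) (t : ℕ) : damped a b t ^ 2 ≤
    (1 / 2) ^ t * (16 / 7 * (b ^ 2 + 1 / 2 * b * a + 1 / 2 * a ^ 2)) := by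
  have h := damped_energy a b t
  -- Completing the square, the form is (b + a/4)² + (7/16) a² in consecutive values a, b; hence the
  -- constant 16/7.
  nlinarith [sq_nonneg (damped a b (t + 1) + 1 / 4 * damped a b t)]

theorem abs_damped_le (a b : ℝ) : ∃ K, 0 ≤ K ∧ ∀ t, |damped a b t| ≤ K * √(1 / 2) ^ t := by
  refine ⟨√(16 / 7 * (b ^ 2 + 1 / 2 * b * a + 1 / 2 * a ^ 2)), Real.sqrt_nonneg _, fun t => ?_⟩
  have hE : 0 ≤ 16 / 7 * (b ^ 2 + 1 / 2 * b * a + 1 / 2 * a ^ 2) := by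
    nlinarith [sq_nonneg (b + 1 / 4 * a), sq_nonneg a]
  refine abs_le_of_sq_le_sq ?_ (by positivity)
  rw [mul_pow, Real.sq_sqrt hE, ← pow_mul, mul_comm t 2, pow_mul, Real.sq_sqrt (by norm_num),
    mul_comm]
  exact damped_sq_le a b t

theorem sqrt_half_pow (t : ℕ) : √(1 / 2) ^ t = (2 : ℝ) ^ (-(t : ℝ) / 2) := by
  rw [Real.sqrt_eq_rpow, ← Real.rpow_natCast, ← Real.rpow_mul (by norm_num), one_div,
    Real.inv_rpow (by norm_num), ← Real.rpow_neg (by norm_num)]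
  congr 1
  ring

/-- Eliminating the odd time from the energy relates two consecutive even times, the only ones for
which the origin lies on the sublattice x + t even. Both values cannot be small at once, which gives
the lower bound. -/
theorem damped_even_energy (t : ℕ) :
    damped (1 / 4) 0 (2 * t + 2) ^ 2 + 3 / 4 * damped (1 / 4) 0 (2 * t + 2) *
      damped (1 / 4) 0 (2 * t) + 1 / 4 * damped (1 / 4) 0 (2 * t) ^ 2 = (1 / 4) ^ t * (1 / 128) := by
  have h := damped_energy (1 / 4) 0 (2 * t)
  rw [pow_mul] at h
  norm_num at h
  rw [damped_add_two]
  linear_combination 1 / 4 * h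

theorem exists_damped_even_ge (t : ℕ) : ∃ s, (s = t ∨ s = t + 1) ∧
    1 / 64 * (2 : ℝ) ^ (-((2 * s : ℕ) : ℝ) / 2) ≤ |damped (1 / 4) 0 (2 * s)| := by
  by_contra! hcon
  have h1 := hcon t (Or.inl rfl)
  have h2 := hcon (t + 1) (Or.inr rfl)
  rw [← sqrt_half_pow, pow_mul, Real.sq_sqrt (by norm_num)] at h1 h2
  have h := damped_even_energy t
  rw [mul_add, mul_one] at h2
  have e : ((1 : ℝ) / 4) ^ t = ((1 / 2) ^ t) ^ 2 := by rw [← pow_mul, mul_comm, pow_mul]; norm_num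
  rw [e] at h
  rw [pow_succ] at h2
  have hpos : (0 : ℝ) < (1 / 2) ^ t := by positivity
  revert h h1 h2 hpos
  generalize ((1 : ℝ) / 2) ^ t = r
  generalize damped (1 / 4) 0 (2 * t) = a
  generalize damped (1 / 4) 0 (2 * t + 2) = b
  intro h1 h2 h hpos
  rw [abs_lt] at h1 h2
  have ha : a ^ 2 ≤ (1 / 64 * r) ^ 2 := sq_le_sq' (by linarith) (by linarith)
  have hb : b ^ 2 ≤ (1 / 64 * r) ^ 2 := sq_le_sq' (by linarith) (by linarith)
  nlinarith [sq_nonneg (a - b), sq_nonneg (a + b), mul_pos hpos hpos]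

theorem damped_eq_complex (t : ℕ) : ((damped (1 / 4) 0 t : ℝ) : ℂ) =
    (2 : ℂ) ^ (-2 * (t : ℤ) - 3) *
      ((1 + Complex.I / (√7 : ℝ)) * (-1 - Complex.I * (√7 : ℝ)) ^ t +
       (1 - Complex.I / (√7 : ℝ)) * (-1 + Complex.I * (√7 : ℝ)) ^ t) := by
  have h7 : ((√7 : ℝ) : ℂ) ^ 2 = 7 := by
    rw [← Complex.ofReal_pow, Real.sq_sqrt (by norm_num)]
    norm_num
  have h0 : ((√7 : ℝ) : ℂ) ≠ 0 := by
    intro h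
    rw [h] at h7
    norm_num at h7
  have hI := Complex.I_sq
  have hp : ∀ t : ℕ, (2 : ℂ) ^ (-2 * (t : ℤ) - 3) = (1 / 8) * (1 / 4) ^ t := by
    intro t
    rw [show -2 * (t : ℤ) - 3 = -((2 * t + 3 : ℕ) : ℤ) by push_cast; ring, zpow_neg, zpow_natCast,
      pow_add, pow_mul, mul_inv, one_div, one_div, inv_pow]
    norm_num
    ring
  revert h7 h0
  generalize ((√7 : ℝ) : ℂ) = r
  intro h7 h0
  have hr : ∀ t : ℕ, (2 : ℂ) ^ (-2 * (t : ℤ) - 3) * ((1 + Complex.I / r) * (-1 - Complex.I * r) ^ t +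
       (1 - Complex.I / r) * (-1 + Complex.I * r) ^ t) = (1 / 8) *
       ((1 + Complex.I / r) * ((-1 - Complex.I * r) / 4) ^ t +
       (1 - Complex.I / r) * ((-1 + Complex.I * r) / 4) ^ t) := by
    intro t
    rw [hp, div_pow, div_pow, div_pow, one_pow]
    ring
  rw [hr]
  have e1 : ((-1 - Complex.I * r) / 4) ^ 2 = -(1 / 2) * ((-1 - Complex.I * r) / 4) - 1 / 2 := by
    linear_combination (1 / 16 * r ^ 2) * hI - 1 / 16 * h7
  have e2 : ((-1 + Complex.I * r) / 4) ^ 2 = -(1 / 2) * ((-1 + Complex.I * r) / 4) - 1 / 2 := by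
    linear_combination (1 / 16 * r ^ 2) * hI - 1 / 16 * h7
  induction t using Nat.twoStepInduction with
  | zero =>
    simp [damped]
    norm_num
  | one =>
    simp only [damped, pow_one]
    field_simp
    push_cast
    linear_combination (2 * r) * hI
  | more t ih1 ih2 =>
    rw [damped_add_two]
    push_cast
    rw [ih1, ih2, pow_add _ t 2, pow_add _ t 2, e1, e2]
    ring

/-! ### Binomial weights: uniform bounds and the local limit theorem -/

theorem centralBinom_sq_mul_le (n : ℕ) :
    (n.centralBinom : ℝ) ^ 2 * (2 * n + 1) ≤ (4 ^ n) ^ 2 := by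
  induction n with
  | zero => simp
  | succ n ih =>
    have h : ((n : ℝ) + 1) * (n + 1).centralBinom = 2 * (2 * n + 1) * n.centralBinom := by
      exact_mod_cast Nat.succ_mul_centralBinom_succ n
    have hn : (0 : ℝ) < (n + 1) ^ 2 := by positivity
    refine le_of_mul_le_mul_left ?_ hn
    calc ((n : ℝ) + 1) ^ 2 * (((n + 1).centralBinom : ℝ) ^ 2 * (2 * (n + 1 : ℕ) + 1))
        = (((n : ℝ) + 1) * ((n + 1).centralBinom : ℝ)) ^ 2 * (2 * (n : ℝ) + 3) := by push_cast; ring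
      _ = 4 * ((2 * (n : ℝ) + 1) * (2 * n + 3)) * ((n.centralBinom : ℝ) ^ 2 * (2 * n + 1)) := by rw [h]; ring
      _ ≤ 4 * ((2 * (n : ℝ) + 1) * (2 * n + 3)) * (4 ^ n) ^ 2 := by gcongr
      _ ≤ 4 * (4 * ((n : ℝ) + 1) ^ 2) * (4 ^ n) ^ 2 :=
        mul_le_mul_of_nonneg_right (by nlinarith) (by positivity)
      _ = ((n : ℝ) + 1) ^ 2 * (4 ^ (n + 1)) ^ 2 := by ring

/-- A bound of order N^(-1/2) on all binomial weights, by comparison with the central one; it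
provides the domination in the Duhamel sum. -/
theorem choose_div_two_pow_sq_mul_le (N j : ℕ) :
    ((N.choose j : ℝ) / 2 ^ N) ^ 2 * (N + 1) ≤ 2 := by
  have key : ∃ n : ℕ, N ≤ 2 * n + 1 ∧ (N.choose j : ℝ) / 2 ^ N ≤ n.centralBinom / 4 ^ n := by
    rcases Nat.even_or_odd' N with ⟨n, rfl | rfl⟩
    · refine ⟨n, by omega, ?_⟩
      rw [pow_mul]
      norm_num
      gcongr
      exact Nat.choose_le_centralBinom j n
    · refine ⟨n, le_rfl, ?_⟩
      have h : ((2 * n + 1).choose j : ℝ) ≤ 2 * n.centralBinom := by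
        rcases j with _ | j
        · have := Nat.centralBinom_pos n
          simp only [Nat.choose_zero_right]
          norm_cast
          omega
        · rw [Nat.choose_succ_succ']
          have h1 := Nat.choose_le_centralBinom j n
          have h2 := Nat.choose_le_centralBinom (j + 1) n
          norm_cast
          omega
      rw [pow_succ, pow_mul, div_le_div_iff₀ (by positivity) (by positivity)]
      norm_num
      nlinarith [pow_pos (show (0 : ℝ) < 4 by norm_num) n]
  obtain ⟨n, hn, hle⟩ := key
  have hN : (N : ℝ) + 1 ≤ 2 * (2 * n + 1) := by
    have : (N : ℝ) ≤ 2 * n + 1 := by exact_mod_cast hn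
    have h0 : (0 : ℝ) ≤ n := by positivity
    linarith
  have h := centralBinom_sq_mul_le n
  calc ((N.choose j : ℝ) / 2 ^ N) ^ 2 * (N + 1)
      ≤ (n.centralBinom / 4 ^ n) ^ 2 * (2 * (2 * n + 1)) := by gcongr
    _ = 2 * ((n.centralBinom : ℝ) ^ 2 * (2 * n + 1)) / (4 ^ n) ^ 2 := by ring
    _ ≤ 2 := by
      rw [div_le_iff₀ (by positivity)]
      linarith

/-- Chebyshev's inequality for a single value of a symmetric binomial variable. -/
theorem choose_mul_sq_le (N j : ℕ) :
    (N.choose j : ℝ) / 2 ^ N * (2 * j - N) ^ 2 ≤ N := by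
  rcases Nat.lt_or_ge N j with hj | hj
  · rw [Nat.choose_eq_zero_of_lt hj]
    simp
  have h := congrArg (Polynomial.eval (1 / 2 : ℝ)) (bernsteinPolynomial.variance ℝ N)
  rw [Polynomial.eval_finsetSum] at h
  have hle := Finset.single_le_sum (f := fun ν : ℕ => Polynomial.eval (1 / 2 : ℝ)
    ((N • Polynomial.X - (ν : Polynomial ℝ)) ^ 2 * bernsteinPolynomial ℝ N ν))
    (s := Finset.range (N + 1)) (fun ν _ => by
      simp only [bernsteinPolynomial, Polynomial.eval_mul, Polynomial.eval_pow,
        Polynomial.eval_sub, Polynomial.eval_natCast, Polynomial.eval_X, Polynomial.eval_one]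
      refine mul_nonneg (sq_nonneg _) ?_
      norm_num) (Finset.mem_range.2 (Nat.lt_succ_of_le hj))
  rw [h] at hle
  simp only [bernsteinPolynomial, Polynomial.eval_mul, Polynomial.eval_pow, Polynomial.eval_sub,
    Polynomial.eval_natCast, Polynomial.eval_X, Polynomial.eval_one, nsmul_eq_mul] at hle
  have e : (1 / 2 : ℝ) ^ j * (1 - 1 / 2) ^ (N - j) = 1 / 2 ^ N := by
    rw [show (1 : ℝ) - 1 / 2 = 1 / 2 by norm_num, ← pow_add, Nat.add_sub_cancel' hj, one_div_pow]
  rw [mul_assoc (N.choose j : ℝ), e] at hle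
  have e2 : (N.choose j : ℝ) / 2 ^ N * (2 * j - N) ^ 2 =
      4 * ((N * (1 / 2) - j) ^ 2 * (N.choose j * (1 / 2 ^ N))) := by ring
  rw [e2]
  linarith

theorem abs_entropy_sub_sq_le {δ : ℝ} (h : |δ| ≤ 1 / 2) :
    |(1 + δ) * Real.log (1 + δ) + (1 - δ) * Real.log (1 - δ) - δ ^ 2| ≤ 6 * |δ| ^ 3 := by
  have hb : ∀ y : ℝ, |y| ≤ 1 / 2 → |Real.log (1 - y) - (-y - y ^ 2 / 2)| ≤ 2 * |y| ^ 3 := by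
    intro y hy
    have h1 := Real.abs_log_sub_add_sum_range_le (x := y) (by linarith) 2
    rw [Finset.sum_range_succ, Finset.sum_range_one] at h1
    have h2 : |y| ^ (2 + 1) / (1 - |y|) ≤ 2 * |y| ^ 3 := by
      rw [div_le_iff₀ (by linarith)]
      have hnn := mul_nonneg (pow_nonneg (abs_nonneg y) 3) (by linarith : 0 ≤ 1 - 2 * |y|)
      have e : |y| ^ (2 + 1) = 2 * |y| ^ 3 * (1 - |y|) - |y| ^ 3 * (1 - 2 * |y|) := by ring
      rw [e]
      linarith
    refine le_trans (le_of_eq ?_) (h1.trans h2)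
    congr 1
    norm_num
    ring
  have hp := hb (-δ) (by rwa [abs_neg])
  have hm := hb δ h
  rw [abs_neg, sub_neg_eq_add] at hp
  obtain ⟨h1, h2⟩ := abs_le.1 h
  have e : (1 + δ) * Real.log (1 + δ) + (1 - δ) * Real.log (1 - δ) - δ ^ 2 =
      (1 + δ) * (Real.log (1 + δ) - (- -δ - (-δ) ^ 2 / 2)) +
      (1 - δ) * (Real.log (1 - δ) - (-δ - δ ^ 2 / 2)) := by ring
  rw [e]
  refine (abs_add_le _ _).trans ?_
  rw [abs_mul, abs_mul, abs_of_nonneg (by linarith : 0 ≤ 1 + δ),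
    abs_of_nonneg (by linarith : 0 ≤ 1 - δ)]
  nlinarith [abs_nonneg (Real.log (1 + δ) - (- -δ - (-δ) ^ 2 / 2)),
    abs_nonneg (Real.log (1 - δ) - (-δ - δ ^ 2 / 2))]

theorem factorial_eq_stirlingSeq {n : ℕ} (hn : 0 < n) : (n.factorial : ℝ) =
    Stirling.stirlingSeq n * (√(2 * n) * (n / Real.exp 1) ^ n) := by
  have : (0 : ℝ) < n := by exact_mod_cast hn
  rw [Stirling.stirlingSeq, div_mul_cancel₀]
  positivity

/-- Stirling's formula in exact form, with `stirlingSeq` carrying the error and j = N(1 + δ)/2. The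
exponent is an entropy, which is δ² up to a cubic error by `abs_entropy_sub_sq_le`. -/
theorem sqrt_mul_choose_eq {j k : ℕ} (hj : 0 < j) (hk : 0 < k) {δ : ℝ}
    (hδ : (j : ℝ) - k = δ * (j + k)) :
    √((j + k : ℕ) : ℝ) * (((j + k).choose j : ℝ) / 2 ^ (j + k)) =
      Stirling.stirlingSeq (j + k) / (Stirling.stirlingSeq j * Stirling.stirlingSeq k) *
        (√2 / √(1 - δ ^ 2)) * Real.exp (-(((j + k : ℕ) : ℝ) / 2 *
          ((1 + δ) * Real.log (1 + δ) + (1 - δ) * Real.log (1 - δ)))) := by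
  have hj' : (0 : ℝ) < j := by exact_mod_cast hj
  have hk' : (0 : ℝ) < k := by exact_mod_cast hk
  obtain ⟨N, hN⟩ : ∃ N : ℝ, N = j + k := ⟨_, rfl⟩
  have hN0 : 0 < N := by rw [hN]; positivity
  have e1 : 1 + δ = 2 * j / N := by
    rw [eq_div_iff hN0.ne']; rw [← hN] at hδ; linarith
  have e2 : 1 - δ = 2 * k / N := by
    rw [eq_div_iff hN0.ne']; rw [← hN] at hδ; linarith
  have e3 : 1 - δ ^ 2 = 4 * (j * k) / N ^ 2 := by
    rw [show 1 - δ ^ 2 = (1 + δ) * (1 - δ) by ring, e1, e2]; ring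
  have hexp : Real.exp (-(N / 2 * ((1 + δ) * Real.log (1 + δ) + (1 - δ) * Real.log (1 - δ)))) =
      N ^ (j + k) / (2 ^ (j + k) * ((j : ℝ) ^ j * (k : ℝ) ^ k)) := by
    rw [Real.exp_neg]
    have : Real.exp (N / 2 * ((1 + δ) * Real.log (1 + δ) + (1 - δ) * Real.log (1 - δ))) =
        (2 * j / N) ^ j * (2 * k / N) ^ k := by
      rw [e1, e2, ← Real.exp_log (show 0 < (2 * j / N) ^ j * (2 * k / N) ^ k by positivity),
        Real.log_mul (by positivity) (by positivity), Real.log_pow, Real.log_pow]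
      congr 1
      field_simp
    rw [this, div_pow, div_pow, mul_pow, mul_pow, pow_add, pow_add]
    field_simp
  have hs : √(1 - δ ^ 2) = 2 * (√j * √k) / N := by
    rw [e3, Real.sqrt_div (by positivity), Real.sqrt_sq hN0.le, Real.sqrt_mul (by norm_num),
      Real.sqrt_mul hj'.le, show (4 : ℝ) = 2 ^ 2 by norm_num, Real.sqrt_sq (by norm_num)]
  have hc : ((j + k).choose j : ℝ) = (j + k).factorial / (j.factorial * k.factorial) := by
    rw [Nat.choose_symm_add, Nat.add_choose, Nat.cast_div (Nat.factorial_mul_factorial_dvd_factorial_add j k)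
      (by positivity)]
    push_cast
    ring
  have hNc : ((j + k : ℕ) : ℝ) = N := by rw [hN]; push_cast; ring
  have hsj : Stirling.stirlingSeq j ≠ 0 := by
    obtain ⟨i, rfl⟩ := Nat.exists_eq_succ_of_ne_zero hj.ne'
    exact (Stirling.stirlingSeq'_pos i).ne'
  have hsk : Stirling.stirlingSeq k ≠ 0 := by
    obtain ⟨i, rfl⟩ := Nat.exists_eq_succ_of_ne_zero hk.ne'
    exact (Stirling.stirlingSeq'_pos i).ne'
  rw [hc, factorial_eq_stirlingSeq (by omega : 0 < j + k), factorial_eq_stirlingSeq hj,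
    factorial_eq_stirlingSeq hk, hNc, hexp, hs, Real.sqrt_mul (by norm_num),
    Real.sqrt_mul (by norm_num), Real.sqrt_mul (by norm_num), div_pow, div_pow, div_pow]
  have hN2 : √N * √N = N := Real.mul_self_sqrt hN0.le
  have h22 : √2 * √2 = (2 : ℝ) := Real.mul_self_sqrt (by norm_num)
  have hjs : 0 < √(j : ℝ) := Real.sqrt_pos.2 hj'
  have hks : 0 < √(k : ℝ) := Real.sqrt_pos.2 hk'
  have h2s : 0 < √(2 : ℝ) := Real.sqrt_pos.2 (by norm_num)
  rw [pow_add (Real.exp 1)]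
  field_simp
  rw [pow_two, pow_two, h22, hN2]
  ring

/-- The local limit theorem for symmetric binomial variables. -/
theorem tendsto_sqrt_mul_choose {N j : ℕ → ℕ} {w : ℝ} (hN : Tendsto N atTop atTop)
    (hw : Tendsto (fun t => (2 * (j t : ℝ) - N t) / √(N t : ℝ)) atTop (𝓝 w)) :
    Tendsto (fun t => √(N t : ℝ) * (((N t).choose (j t) : ℝ) / 2 ^ N t)) atTop
      (𝓝 (√2 / √Real.pi * Real.exp (-(w ^ 2 / 2)))) := by
  have hNr : Tendsto (fun t => (N t : ℝ)) atTop atTop := tendsto_natCast_atTop_atTop.comp hN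
  have hsN : Tendsto (fun t => √(N t : ℝ)) atTop atTop := Real.tendsto_sqrt_atTop.comp hNr
  set δ : ℕ → ℝ := fun t => (2 * (j t : ℝ) - N t) / N t with hδdef
  have hδs : ∀ t, δ t = (2 * (j t : ℝ) - N t) / √(N t : ℝ) / √(N t : ℝ) := by
    intro t
    rw [div_div, Real.mul_self_sqrt (by positivity)]
  have hδ0 : Tendsto δ atTop (𝓝 0) := by
    simp only [funext hδs]
    exact hw.div_atTop hsN
  have hδsmall : ∀ᶠ t in atTop, |δ t| < 1 / 2 := by
    have := hδ0.abs
    rw [abs_zero] at this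
    exact this.eventually_lt_const (by norm_num)
  have hNpos : ∀ᶠ t in atTop, 0 < N t := hN.eventually_gt_atTop 0
  -- Since |δ| < 1/2, both j and N - j exceed N/4, so Stirling's limit applies to all three
  -- factorials.
  have hgood : ∀ᶠ t in atTop, 0 < N t ∧ N t < 4 * j t ∧ 4 * j t < 3 * N t := by
    filter_upwards [hδsmall, hNpos] with t h1 h2
    have h2' : (0 : ℝ) < N t := by exact_mod_cast h2
    obtain ⟨h3, h4⟩ := abs_lt.1 h1
    rw [lt_div_iff₀ h2'] at h3
    rw [div_lt_iff₀ h2'] at h4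
    refine ⟨h2, ?_, ?_⟩
    · have : (N t : ℝ) < 4 * j t := by linarith
      exact_mod_cast this
    · have : 4 * (j t : ℝ) < 3 * N t := by linarith
      exact_mod_cast this
  have hj : Tendsto j atTop atTop := by
    refine tendsto_atTop.2 fun b => ?_
    filter_upwards [hgood, hN.eventually_ge_atTop (4 * b)] with t h1 h2
    omega
  have hk : Tendsto (fun t => N t - j t) atTop atTop := by
    refine tendsto_atTop.2 fun b => ?_
    filter_upwards [hgood, hN.eventually_ge_atTop (4 * b)] with t h1 h2
    omega
  have hπ : √Real.pi ≠ 0 := by positivity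
  have hS := Stirling.tendsto_stirlingSeq_sqrt_pi
  have h1 := (hS.comp hN).div ((hS.comp hj).mul (hS.comp hk)) (mul_ne_zero hπ hπ)
  have h2 : Tendsto (fun t => √2 / √(1 - δ t ^ 2)) atTop (𝓝 (√2 / √(1 - 0 ^ 2))) := by
    refine tendsto_const_nhds.div ?_ (by norm_num)
    exact (Real.continuous_sqrt.tendsto _).comp (tendsto_const_nhds.sub (hδ0.pow 2))
  have hNδ : ∀ᶠ t in atTop, (N t : ℝ) * δ t ^ 2 = ((2 * (j t : ℝ) - N t) / √(N t : ℝ)) ^ 2 := by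
    filter_upwards [hNpos] with t ht
    have ht' : (0 : ℝ) < N t := by exact_mod_cast ht
    rw [div_pow, div_pow, Real.sq_sqrt ht'.le]
    field_simp
  have hNδ' : Tendsto (fun t => (N t : ℝ) * δ t ^ 2) atTop (𝓝 (w ^ 2)) :=
    (hw.pow 2).congr' (hNδ.mono fun t h => h.symm)
  have h3 : Tendsto (fun t => (N t : ℝ) / 2 *
      ((1 + δ t) * Real.log (1 + δ t) + (1 - δ t) * Real.log (1 - δ t))) atTop (𝓝 (w ^ 2 / 2)) := by
    have hdiff : Tendsto (fun t => (N t : ℝ) / 2 *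
        ((1 + δ t) * Real.log (1 + δ t) + (1 - δ t) * Real.log (1 - δ t) - δ t ^ 2))
        atTop (𝓝 0) := by
      have hz : Tendsto (fun t => 3 * ((N t : ℝ) * δ t ^ 2) * |δ t|) atTop (𝓝 0) := by
        have := (hNδ'.const_mul 3).mul hδ0.abs
        rwa [abs_zero, mul_zero] at this
      refine squeeze_zero_norm' ?_ hz
      filter_upwards [hδsmall] with t ht
      have hb := abs_entropy_sub_sq_le ht.le
      rw [Real.norm_eq_abs, abs_mul, abs_of_nonneg (by positivity : (0 : ℝ) ≤ (N t : ℝ) / 2),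
        ← sq_abs (δ t)]
      rw [← sq_abs (δ t)] at hb
      have hN0 : (0 : ℝ) ≤ N t := by positivity
      nlinarith
    have := hdiff.add (hNδ'.div_const 2)
    rw [zero_add] at this
    refine this.congr fun t => ?_
    ring
  have h4 := (h1.mul h2).mul ((Real.continuous_exp.tendsto _).comp h3.neg)
  have e : √Real.pi / (√Real.pi * √Real.pi) * (√2 / √(1 - 0 ^ 2)) * Real.exp (-(w ^ 2 / 2)) =
      √2 / √Real.pi * Real.exp (-(w ^ 2 / 2)) := by
    norm_num
    field_simp
  rw [e] at h4
  refine h4.congr' ?_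
  filter_upwards [hgood] with t ht
  obtain ⟨k, hk⟩ : ∃ k, N t = j t + k := ⟨N t - j t, by omega⟩
  have ht' : (0 : ℝ) < N t := by exact_mod_cast ht.1
  have h := sqrt_mul_choose_eq (j := j t) (k := k) (δ := δ t) (by omega) (by omega) (by
    have hN' : (N t : ℝ) = j t + k := by exact_mod_cast hk
    rw [← hN', div_mul_cancel₀ _ ht'.ne', hN']
    ring)
  rw [← hk] at h
  rw [h]
  simp only [Function.comp_apply, Pi.div_apply]
  rw [show N t - j t = k by omega]

/-! ### Size of the source and the Duhamel sum -/

theorem source_cases (m s : ℕ) : source m s = 0 ∨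
    ∃ N : ℕ, s = N + 2 * m + 3 ∧ source m s = 1 / 16 * (N.choose m / 2 ^ N) := by
  rcases Nat.lt_or_ge s (2 * m + 3) with h | h
  · left
    rw [source, binom_of_neg (by omega)]
    simp
  · exact Or.inr ⟨s - 2 * m - 3, by omega, source_eq (by omega)⟩

theorem source_nonneg (m s : ℕ) : 0 ≤ source m s := by
  rcases source_cases m s with h | ⟨N, _, h⟩ <;> rw [h]
  positivity

theorem source_sq_mul_le (m s : ℕ) : source m s ^ 2 * ((s : ℝ) - 2 * m - 2) ≤ 1 := by
  rcases source_cases m s with h | ⟨N, hs, h⟩ <;> rw [h]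
  · norm_num
  · have := choose_div_two_pow_sq_mul_le N m
    rw [hs]
    push_cast
    nlinarith

theorem source_mul_sq_le (m s : ℕ) : source m s * (4 * (m : ℝ) + 3 - s) ^ 2 ≤ s := by
  rcases source_cases m s with h | ⟨N, hs, h⟩ <;> rw [h]
  · simp
  · have h1 := choose_mul_sq_le N m
    have hN : (0 : ℝ) ≤ N := by positivity
    have hm : (0 : ℝ) ≤ m := by positivity
    have e : (4 * (m : ℝ) + 3 - s) = 2 * m - N := by
      rw [hs]
      push_cast
      ring
    have e' : (s : ℝ) = N + 2 * m + 3 := by rw [hs]; push_cast; ring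
    rw [e, e', mul_assoc]
    linarith

theorem sqrt_half_lt_one : √(1 / 2 : ℝ) < 1 := by
  rw [Real.sqrt_lt' one_pos]
  norm_num

/-- Exponential decay gives summability; summing the recurrence then gives S - 1/2 = -(S - 1)/2 -
S/2, so S = 1/2. -/
theorem hasSum_damped : HasSum (damped 1 (-(1 / 2))) (1 / 2) := by
  obtain ⟨K, -, hK⟩ := abs_damped_le 1 (-(1 / 2))
  have hs : Summable (damped 1 (-(1 / 2))) := Summable.of_norm_bounded
    ((summable_geometric_of_lt_one (Real.sqrt_nonneg _) sqrt_half_lt_one).mul_left K) hK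
  have h1 := hs.sum_add_tsum_nat_add 1
  have h2 := hs.sum_add_tsum_nat_add 2
  have hs1 := (summable_nat_add_iff 1).2 hs
  have e : ∑' i, damped 1 (-(1 / 2)) (i + 2) = -(1 / 2) * ∑' i, damped 1 (-(1 / 2)) (i + 1) -
      1 / 2 * ∑' i, damped 1 (-(1 / 2)) i := by
    rw [← tsum_mul_left, ← tsum_mul_left, ← (hs1.mul_left _).tsum_sub (hs.mul_left _)]
    exact tsum_congr fun i => damped_add_two _ _ i
  rw [e] at h2
  simp only [Finset.sum_range_succ, Finset.sum_range_zero, damped] at h1 h2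
  convert hs.hasSum using 1
  linarith

theorem tendsto_sqrt_mul_damped {T : ℕ → ℕ} (hT : ∀ t, t ≤ T t) (a b : ℝ) :
    Tendsto (fun t : ℕ => √(t : ℝ) * damped a b (T t)) atTop (𝓝 0) := by
  obtain ⟨K, hK0, hK⟩ := abs_damped_le a b
  have hz := (tendsto_self_mul_const_pow_of_lt_one (Real.sqrt_nonneg _)
    sqrt_half_lt_one).const_mul K
  rw [mul_zero] at hz
  refine squeeze_zero_norm (fun t => ?_) hz
  rw [Real.norm_eq_abs, abs_mul, abs_of_nonneg (Real.sqrt_nonneg _)]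
  have h1 : √(t : ℝ) ≤ t := by
    rcases Nat.eq_zero_or_pos t with rfl | ht
    · simp
    · have : (1 : ℝ) ≤ t := by exact_mod_cast ht
      rw [Real.sqrt_le_left (by linarith)]
      nlinarith
  have h2 : √(1 / 2 : ℝ) ^ T t ≤ √(1 / 2) ^ t :=
    pow_le_pow_of_le_one (Real.sqrt_nonneg _) sqrt_half_lt_one.le (hT t)
  calc √(t : ℝ) * |damped a b (T t)| ≤ t * (K * √(1 / 2) ^ t) :=
        mul_le_mul h1 ((hK _).trans (by gcongr)) (abs_nonneg _) (by positivity)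
    _ = K * (t * √(1 / 2) ^ t) := by ring

/-- The profile behaves like half of its source, wherever the source varies slowly. -/
theorem tendsto_sqrt_mul_profile {M T : ℕ → ℕ} {C ℓ : ℝ} (hT : ∀ t, t ≤ T t)
    (hC : ∀ᶠ t : ℕ in atTop, (t : ℝ) ≤ C * ((T t : ℝ) - 2 * M t - 4))
    (hℓ : ∀ k : ℕ, Tendsto (fun t : ℕ => √(t : ℝ) * source (M t) (T t - 2 - k)) atTop (𝓝 ℓ)) :
    Tendsto (fun t : ℕ => √(t : ℝ) * profile (M t) (T t)) atTop (𝓝 (ℓ / 2)) := by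
  obtain ⟨K, hK0, hK⟩ := abs_damped_le 1 (-(1 / 2))
  set f : ℕ → ℕ → ℝ := fun t k => if k < T t - 1 then
    √(t : ℝ) * (damped 1 (-(1 / 2)) k * source (M t) (T t - 2 - k)) else 0 with hf
  have hTlim : Tendsto T atTop atTop := tendsto_atTop_mono hT tendsto_id
  have hpt : ∀ k, Tendsto (fun t => f t k) atTop (𝓝 (damped 1 (-(1 / 2)) k * ℓ)) := by
    intro k
    refine ((hℓ k).const_mul (damped 1 (-(1 / 2)) k)).congr' ?_
    filter_upwards [hTlim.eventually_ge_atTop (k + 2)] with t ht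
    simp only [hf]
    rw [if_pos (by omega)]
    ring
  have hsum : Summable fun k : ℕ => K * √(1 / 2) ^ k * (√(|C|) * (k + 1)) := by
    have h1 := summable_pow_mul_geometric_of_norm_lt_one 1 (r := √(1 / 2 : ℝ)) (by
      rw [Real.norm_of_nonneg (Real.sqrt_nonneg _)]
      exact sqrt_half_lt_one)
    have h2 := summable_geometric_of_lt_one (Real.sqrt_nonneg (1 / 2)) sqrt_half_lt_one
    refine ((h1.add h2).mul_left (K * √(|C|))).congr fun k => ?_
    ring
  -- Domination: the source at delay k is a weight with N trials, and N + k + 1 ≤ (N + 1)(k + 1).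
  -- The bound N^(-1/2) thus costs only a factor growing polynomially in k, which the geometric
  -- decay of the kernel beats.
  have hbound : ∀ᶠ t in atTop, ∀ k, ‖f t k‖ ≤ K * √(1 / 2) ^ k * (√(|C|) * (k + 1)) := by
    filter_upwards [hC] with t ht k
    simp only [hf]
    split_ifs with hk
    · rw [Real.norm_eq_abs, mul_left_comm, abs_mul]
      refine mul_le_mul (hK k) ?_ (abs_nonneg _) (by positivity)
      have hcast : ((T t - 2 - k : ℕ) : ℝ) = T t - 2 - k := by
        rw [Nat.sub_sub, Nat.cast_sub (by omega)]
        push_cast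
        ring
      have hS := source_sq_mul_le (M t) (T t - 2 - k)
      rw [hcast] at hS
      have hS0 := source_nonneg (M t) (T t - 2 - k)
      refine abs_le_of_sq_le_sq ?_ (by positivity)
      rw [mul_pow, mul_pow, Real.sq_sqrt (by positivity), Real.sq_sqrt (abs_nonneg C)]
      have hk0 : (0 : ℝ) ≤ k := by positivity
      rcases source_cases (M t) (T t - 2 - k) with h0 | ⟨N, hN, -⟩
      · rw [h0]
        norm_num
        positivity
      · have hN' : (T t : ℝ) - 2 * M t - 4 = N + k + 1 := by
          have : (T t : ℝ) - 2 - k = N + 2 * M t + 3 := by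
            rw [← hcast, hN]
            push_cast
            ring
          linarith
        have hN0 : (0 : ℝ) ≤ N := by positivity
        have hS' : source (M t) (T t - 2 - k) ^ 2 * (N + 1) ≤ 1 := by
          refine le_trans (le_of_eq ?_) hS
          congr 1
          linarith
        rw [hN'] at ht
        have ht' : (t : ℝ) ≤ |C| * ((N + 1) * (k + 1)) := by
          refine ht.trans (mul_le_mul (le_abs_self C) ?_ (by positivity) (abs_nonneg C))
          nlinarith
        calc (t : ℝ) * source (M t) (T t - 2 - k) ^ 2
            ≤ |C| * ((N + 1) * (k + 1)) * source (M t) (T t - 2 - k) ^ 2 := by gcongr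
          _ = |C| * (k + 1) * (source (M t) (T t - 2 - k) ^ 2 * (N + 1)) := by ring
          _ ≤ |C| * (k + 1) * 1 := by gcongr
          _ ≤ |C| * (k + 1) ^ 2 := by
            rw [mul_one]
            gcongr
            nlinarith
    · rw [norm_zero]
      positivity
  have hlim := tendsto_tsum_of_dominated_convergence hsum hpt hbound
  rw [tsum_mul_right, hasSum_damped.tsum_eq] at hlim
  have h := (tendsto_sqrt_mul_damped hT (1 / 4) 0).add hlim
  rw [zero_add, one_div_mul_eq_div] at h
  refine h.congr' ?_
  filter_upwards [hTlim.eventually_ge_atTop 2] with t ht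
  obtain ⟨s, hs⟩ : ∃ s, T t = s + 2 := ⟨T t - 2, by omega⟩
  rw [tsum_eq_sum (s := Finset.range (s + 1)) (fun k hk => by
    rw [Finset.mem_range] at hk
    simp only [hf]
    rw [if_neg (by omega)]), hs, profile_eq_sum, mul_add, Finset.mul_sum]
  congr 1
  refine Finset.sum_congr rfl fun k hk => ?_
  rw [Finset.mem_range] at hk
  simp only [hf]
  rw [if_pos (by omega), show T t - 2 - k = s - k by omega]

/-! ### Reduction of the structure factor to the profile -/

section Reduction

variable {n : ℕ} [NeZero n] {x : ℤ} {t : ℕ}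

theorem structureFactor_eq_closedForm (h : Admissible n x t) (hxt : Even (x + t))
    (h0 : ¬ (x = 0 ∧ t = 0)) : structureFactor n x t = closedForm x t := by
  obtain ⟨hn, ht, h1, h2⟩ := h
  rw [closedForm_eq, structureFactor_eq_partialForm hn x t (by omega) hxt h1 h2 h0]

theorem structureFactor_odd (h : Admissible n x t) (hxt : Odd (x + t)) :
    structureFactor n x t = structureFactor n x (t + 1) ∧
      structureFactor n x t = closedForm x (t + 1) := by
  obtain ⟨hn, ht, h1, h2⟩ := h
  have h := structureFactor_add_one (even_iff_two_dvd.1 hn) x t hxt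
  refine ⟨h.symm, ?_⟩
  obtain ⟨k, hk⟩ := hn
  rw [closedForm_eq, ← h, structureFactor_eq_partialForm ⟨k, hk⟩ x (t + 1) (by omega) _ h1 h2
    (by omega)]
  push_cast
  rw [← add_assoc]
  exact hxt.add_one

theorem structureFactor_zero_zero (hn : 2 ∣ n) : structureFactor n 0 0 = 1 / 4 := by
  have h := structureFactor_eq_corr hn 0 0 (by simp)
  simpa [corr_zero_zero] using h

/-- Treats both sublattices at once, with T = t or t + 1 chosen so that x + T is even. The
artificial value 1/4 of `profile` at time zero is also the true value at the origin, so that point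
needs no exclusion. Outside the light cone the truncated subtraction gives m = 0. -/
theorem exists_profile (h : Admissible n x t) : ∃ T m : ℕ, (T = t ∨ T = t + 1) ∧ Even (x + T) ∧
    m = (((T : ℤ) - |x|) / 2).toNat - 1 ∧ (structureFactor n x t = profile m T ∨
      structureFactor n x t = 0 ∧ (T : ℤ) ≤ |x| ∧ x ≠ 0) := by
  have key : ∀ T : ℕ, Even (x + T) → ¬ (x = 0 ∧ T = 0) →
      structureFactor n x t = closedForm x T →
      (structureFactor n x t = profile ((((T : ℤ) - |x|) / 2).toNat - 1) T ∨
        structureFactor n x t = 0 ∧ (T : ℤ) ≤ |x| ∧ x ≠ 0) := by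
    intro T hT h0 hc
    rw [hc, closedForm_eq]
    by_cases hle : (T : ℤ) ≤ |x|
    · right
      refine ⟨?_, hle, ?_⟩
      · rw [show (((T : ℤ) - |x|) / 2).toNat = 0 by omega]
        simp [partialForm]
      · rintro rfl
        simp at hle
        exact h0 ⟨rfl, hle⟩
    · left
      obtain ⟨k, hk⟩ := hT
      rw [profile, if_neg (by have := abs_nonneg x; omega)]
      congr 1
      rcases abs_choice x with hx | hx <;> omega
  rcases Int.even_or_odd (x + t) with hxt | hxt
  · by_cases h0 : x = 0 ∧ t = 0
    · obtain ⟨rfl, rfl⟩ := h0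
      refine ⟨0, 0, Or.inl rfl, hxt, by simp, Or.inl ?_⟩
      rw [structureFactor_zero_zero (even_iff_two_dvd.1 h.1), profile_zero]
    · exact ⟨t, _, Or.inl rfl, hxt, rfl, key t hxt h0 (structureFactor_eq_closedForm h hxt h0)⟩
  · have hT : Even (x + (t + 1 : ℕ)) := by
      push_cast
      rw [← add_assoc]
      exact hxt.add_one
    exact ⟨t + 1, _, Or.inr rfl, hT, rfl,
      key (t + 1) hT (by omega) (by rw [(structureFactor_odd h hxt).2])⟩

theorem structureFactor_eq_damped (h : Admissible n x t) (hx : (|x| : ℝ) < ((t : ℝ) + 1) / 3) :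
    ∃ T : ℕ, (T = t ∨ T = t + 1) ∧ Even (x + T) ∧
      structureFactor n x t = damped (1 / 4) 0 T := by
  have hx' : 3 * |x| < t + 1 := by
    have : 3 * |(x : ℝ)| < t + 1 := by linarith
    rw [← Int.cast_abs] at this
    exact_mod_cast this
  obtain ⟨T, m, hT, he, rfl, hp | ⟨-, hle, h0⟩⟩ := exists_profile h
  -- For 2(m + 1) = T - |x|, the condition `T < 3 * m + 5` amounts to 3|x| < T + 4.
  · exact ⟨T, hT, he, by rw [hp, profile_eq_damped (by omega)]⟩
  · have := abs_pos.2 h0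
    omega

theorem structureFactor_eq_damped_of_even (h : Admissible n x t) (hxt : Even (x + t))
    (hx : (|x| : ℝ) < ((t : ℝ) + 1) / 3) : structureFactor n x t = damped (1 / 4) 0 t := by
  obtain ⟨T, rfl | rfl, he, hp⟩ := structureFactor_eq_damped h hx
  · exact hp
  · obtain ⟨a, ha⟩ := hxt
    obtain ⟨b, hb⟩ := he
    push_cast at hb
    omega

end Reduction

theorem exists_structureFactor_decay : ∃ K : ℝ, ∀ (n : ℕ) [NeZero n] (x : ℤ) (t : ℕ),
    Admissible n x t → (|x| : ℝ) < ((t : ℝ) + 1) / 3 →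
      |structureFactor n x t| ≤ K * (2 : ℝ) ^ (-(t : ℝ) / 2) := by
  obtain ⟨K, hK0, hK⟩ := abs_damped_le (1 / 4) 0
  refine ⟨K, fun n _ x t h hx => ?_⟩
  obtain ⟨T, hT, -, hp⟩ := structureFactor_eq_damped h hx
  rw [hp, ← sqrt_half_pow]
  refine (hK T).trans ?_
  gcongr ?_ * ?_
  exact pow_le_pow_of_le_one (Real.sqrt_nonneg _) sqrt_half_lt_one.le (by omega)

theorem exists_structureFactor_ge : ∃ c : ℝ, 0 < c ∧ ∃ᶠ t : ℕ in atTop, ∀ (n : ℕ) [NeZero n],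
    Admissible n 0 t → c * (2 : ℝ) ^ (-(t : ℝ) / 2) ≤ |structureFactor n 0 t| := by
  refine ⟨1 / 64, by norm_num, Filter.frequently_atTop.2 fun a => ?_⟩
  obtain ⟨s, hs, hge⟩ := exists_damped_even_ge a
  refine ⟨2 * s, by omega, fun n _ h => ?_⟩
  rw [structureFactor_eq_damped_of_even h (by simp) (by simp; positivity)]
  exact hge

/-! ### Gaussian peaks and vanishing along other rays -/

section Limits

theorem tendsto_sqrt_natCast : Tendsto (fun t : ℕ => √(t : ℝ)) atTop atTop :=
  Real.tendsto_sqrt_atTop.comp tendsto_natCast_atTop_atTop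

theorem tendsto_div_sqrt_of_bounded {f : ℕ → ℝ} {c : ℝ} (h : ∀ t, |f t| ≤ c) :
    Tendsto (fun t : ℕ => f t / √(t : ℝ)) atTop (𝓝 0) := by
  refine squeeze_zero_norm (fun t => ?_)
    ((tendsto_const_nhds (x := c)).div_atTop tendsto_sqrt_natCast)
  rw [Real.norm_eq_abs, abs_div, abs_of_nonneg (Real.sqrt_nonneg _)]
  gcongr
  exact h t

/-- The source on the scale `√t` around the peak. -/
theorem tendsto_sqrt_mul_source {M T a : ℕ → ℕ} {ζ : ℝ} (k : ℕ) (hT : ∀ t, T t = t ∨ T t = t + 1)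
    (hM : ∀ᶠ t in atTop, T t = a t + 2 * M t + 2)
    (ha : Tendsto (fun t : ℕ => ((a t : ℝ) - (t : ℝ) / 2) / √(t : ℝ)) atTop (𝓝 ζ))
    (ha' : Tendsto (fun t : ℕ => (a t : ℝ) / (t : ℝ)) atTop (𝓝 (1 / 2))) :
    Tendsto (fun t : ℕ => √(t : ℝ) * source (M t) (T t - 2 - k)) atTop
      (𝓝 (Real.exp (-4 * ζ ^ 2) / (8 * √Real.pi))) := by
  have hpos : ∀ᶠ t : ℕ in atTop, 0 < t := eventually_gt_atTop 0
  have hinv : Tendsto (fun t : ℕ => ((3 + k : ℝ)) / (t : ℝ)) atTop (𝓝 0) :=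
    tendsto_const_nhds.div_atTop tendsto_natCast_atTop_atTop
  have hak : ∀ᶠ t : ℕ in atTop, 3 + k < a t := by
    have h := (ha'.sub hinv).eventually_const_lt (show (0 : ℝ) < 1 / 2 - 0 by norm_num)
    filter_upwards [h, hpos] with t h1 h2
    have h2' : (0 : ℝ) < t := by exact_mod_cast h2
    rw [← sub_div] at h1
    have h3 := (div_pos_iff_of_pos_right h2').1 h1
    have : ((3 + k : ℕ) : ℝ) < a t := by push_cast; linarith
    exact_mod_cast this
  have hNcast : ∀ᶠ t : ℕ in atTop, ((a t - 3 - k : ℕ) : ℝ) = a t - (3 + k) := by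
    filter_upwards [hak] with t ht
    rw [Nat.sub_sub, Nat.cast_sub ht.le]
    push_cast
    ring
  have hNt : Tendsto (fun t : ℕ => ((a t - 3 - k : ℕ) : ℝ) / t) atTop (𝓝 (1 / 2)) := by
    have := ha'.sub hinv
    rw [sub_zero] at this
    refine this.congr' ?_
    filter_upwards [hNcast] with t ht
    rw [ht, sub_div]
  have hN : Tendsto (fun t : ℕ => a t - 3 - k) atTop atTop := by
    rw [← tendsto_natCast_atTop_iff (R := ℝ)]
    have := hNt.pos_mul_atTop (by norm_num) tendsto_natCast_atTop_atTop
    refine this.congr' ?_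
    filter_upwards [hpos] with t ht
    have ht' : (0 : ℝ) < t := by exact_mod_cast ht
    exact div_mul_cancel₀ _ ht'.ne'
  have hratio : Tendsto (fun t : ℕ => √(t : ℝ) / √((a t - 3 - k : ℕ) : ℝ)) atTop (𝓝 (√2)) := by
    have h := (Real.continuous_sqrt.tendsto _).comp (hNt.inv₀ (by norm_num))
    rw [show ((1 : ℝ) / 2)⁻¹ = 2 by norm_num] at h
    refine h.congr fun t => ?_
    rw [Function.comp_apply, inv_div, Real.sqrt_div (by positivity)]
  -- With N = a - 3 - k trials, the deviation 2M - N is -2(a - t/2) up to a bounded term, and √t/√N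
  -- tends to √2. The standardized deviation tends to -2√2 ζ, whence the exponent -4ζ².
  have hdev : Tendsto (fun t : ℕ => (2 * (M t : ℝ) - (a t - 3 - k : ℕ)) / √((a t - 3 - k : ℕ) : ℝ))
      atTop (𝓝 ((-2 * ζ + 0) * √2)) := by
    have hb : Tendsto (fun t : ℕ => ((T t : ℝ) - t + 1 + k) / √(t : ℝ)) atTop (𝓝 0) := by
      refine tendsto_div_sqrt_of_bounded (c := 2 + k) fun t => ?_
      rcases hT t with h | h <;> rw [h] <;> push_cast
      · rw [sub_self, abs_of_nonneg (by positivity)]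
        linarith
      · rw [show (t : ℝ) + 1 - t + 1 + k = 2 + k by ring, abs_of_nonneg (by positivity)]
    refine (((ha.const_mul (-2)).add hb).mul hratio).congr' ?_
    filter_upwards [hNcast, hM, hpos] with t h1 h2 h3
    have h3' : 0 < √(t : ℝ) := Real.sqrt_pos.2 (by exact_mod_cast h3)
    have h2' : (T t : ℝ) = a t + 2 * M t + 2 := by exact_mod_cast h2
    have e : 2 * (M t : ℝ) - (a t - 3 - k : ℕ) = -2 * ((a t : ℝ) - t / 2) + (T t - t + 1 + k) := by
      rw [h1, h2']
      ring
    rw [e]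
    field_simp
  have hchoose := tendsto_sqrt_mul_choose hN hdev
  have hfin := (hratio.mul hchoose).const_mul (1 / 16)
  have e : 1 / 16 * (√2 * (√2 / √Real.pi * Real.exp (-(((-2 * ζ + 0) * √2) ^ 2 / 2)))) =
      Real.exp (-4 * ζ ^ 2) / (8 * √Real.pi) := by
    have h2 : √2 * √2 = (2 : ℝ) := Real.mul_self_sqrt (by norm_num)
    have h2' : √2 ^ 2 = (2 : ℝ) := Real.sq_sqrt (by norm_num)
    rw [mul_pow, h2', show -((-2 * ζ + 0) ^ 2 * 2 / 2) = -4 * ζ ^ 2 by ring,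
      show 1 / 16 * (√2 * (√2 / √Real.pi * Real.exp (-4 * ζ ^ 2))) =
        1 / 16 * (√2 * √2) * Real.exp (-4 * ζ ^ 2) / √Real.pi by ring, h2]
    field_simp
    norm_num
  rw [e] at hfin
  refine hfin.congr' ?_
  filter_upwards [hak, hM] with t h1 h2
  have hpos : 0 < √((a t - 3 - k : ℕ) : ℝ) := Real.sqrt_pos.2 (by
    have : 0 < a t - 3 - k := by omega
    exact_mod_cast this)
  rw [source_eq (N := a t - 3 - k) (by omega)]
  field_simp

theorem tendsto_structureFactor_peak (σ : ℤ) (ζ : ℝ) (x : ℕ → ℤ) (n : ℕ → ℕ) [∀ t, NeZero (n t)]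
    (hσ : σ = 1 ∨ σ = -1) (hadm : ∀ t, Admissible (n t) (x t) t)
    (hx : Tendsto (fun t : ℕ => ((σ : ℝ) * (x t : ℝ) - (t : ℝ) / 2) / √(t : ℝ)) atTop (𝓝 ζ)) :
    Tendsto (fun t : ℕ => √(t : ℝ) * structureFactor (n t) (x t) t) atTop
      (𝓝 (Real.exp (-4 * ζ ^ 2) / (16 * √Real.pi))) := by
  have hpos : ∀ᶠ t : ℕ in atTop, 0 < t := eventually_gt_atTop 0
  have hdiv : Tendsto (fun t : ℕ => (σ : ℝ) * (x t : ℝ) / t) atTop (𝓝 (1 / 2)) := by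
    have h := (hx.div_atTop tendsto_sqrt_natCast).add_const (1 / 2)
    rw [zero_add] at h
    refine h.congr' ?_
    filter_upwards [hpos] with t ht
    have ht' : (0 : ℝ) < t := by exact_mod_cast ht
    rw [div_div, Real.mul_self_sqrt ht'.le]
    field_simp
    ring
  have habs : ∀ᶠ t : ℕ in atTop, ((x t).natAbs : ℝ) = σ * x t := by
    filter_upwards [hdiv.eventually_const_lt (show (0 : ℝ) < 1 / 2 by norm_num), hpos] with t h1 h2
    have h2' : (0 : ℝ) < t := by exact_mod_cast h2
    have h3 : (0 : ℝ) < ((σ * x t : ℤ) : ℝ) := by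
      push_cast
      exact (div_pos_iff_of_pos_right h2').1 h1
    have h4 : 0 < σ * x t := by exact_mod_cast h3
    have h5 : ((x t).natAbs : ℤ) = σ * x t := by
      rcases hσ with rfl | rfl <;> omega
    rw [← Int.cast_natCast, h5]
    push_cast
    ring
  have ha : Tendsto (fun t : ℕ => (((x t).natAbs : ℝ) - (t : ℝ) / 2) / √(t : ℝ)) atTop (𝓝 ζ) :=
    hx.congr' (habs.mono fun t h => by dsimp only; rw [h])
  have ha' : Tendsto (fun t : ℕ => ((x t).natAbs : ℝ) / (t : ℝ)) atTop (𝓝 (1 / 2)) :=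
    hdiv.congr' (habs.mono fun t h => by dsimp only; rw [h])
  have hrange : ∀ᶠ t : ℕ in atTop, 16 ≤ t ∧ t < 4 * (x t).natAbs ∧ 4 * (x t).natAbs < 3 * t := by
    filter_upwards [ha'.eventually_const_lt (show (1 / 4 : ℝ) < 1 / 2 by norm_num),
      ha'.eventually_lt_const (show (1 / 2 : ℝ) < 3 / 4 by norm_num),
      eventually_ge_atTop 16] with t h1 h2 h3
    have h3' : (0 : ℝ) < t := by
      have : 0 < t := by omega
      exact_mod_cast this
    rw [lt_div_iff₀ h3'] at h1
    rw [div_lt_iff₀ h3'] at h2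
    refine ⟨h3, ?_, ?_⟩
    · have : (t : ℝ) < 4 * (x t).natAbs := by linarith
      exact_mod_cast this
    · have : 4 * ((x t).natAbs : ℝ) < 3 * t := by linarith
      exact_mod_cast this
  choose T M hT he hM hp using fun t => exists_profile (hadm t)
  have hMT : ∀ᶠ t in atTop, T t = (x t).natAbs + 2 * M t + 2 := by
    filter_upwards [hrange] with t ht
    obtain ⟨j, hj⟩ := he t
    have h1 := hM t
    have h2 := hT t
    rw [Int.abs_eq_natAbs] at h1
    omega
  -- The constant 8: here T - 2M - 4 = |x| - 2 > t/4 - 2, which is at least t/8 once t ≥ 16.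
  have hprof := tendsto_sqrt_mul_profile (M := M) (T := T) (C := 8) (fun t => by
    have := hT t
    omega) (by
      filter_upwards [hrange, hMT] with t h1 h2
      have h3 : (T t : ℝ) = (x t).natAbs + 2 * M t + 2 := by exact_mod_cast h2
      have h4 : (t : ℝ) < 4 * (x t).natAbs := by exact_mod_cast h1.2.1
      have h5 : (16 : ℝ) ≤ t := by exact_mod_cast h1.1
      linarith) (fun k => tendsto_sqrt_mul_source k hT hMT ha ha')
  rw [show Real.exp (-4 * ζ ^ 2) / (8 * √Real.pi) / 2 =
    Real.exp (-4 * ζ ^ 2) / (16 * √Real.pi) by rw [div_div]; ring_nf] at hprof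
  refine hprof.congr' ?_
  filter_upwards [hrange] with t ht
  rcases hp t with h | ⟨-, h, -⟩
  · rw [h]
  · rw [Int.abs_eq_natAbs] at h
    have := hT t
    omega

/-- The source away from the peaks. -/
theorem tendsto_sqrt_mul_source_zero {M T : ℕ → ℕ} {c : ℝ} (hc : 0 < c) (k : ℕ)
    (hT : ∀ t, T t = t ∨ T t = t + 1)
    (hD : ∀ᶠ t : ℕ in atTop, c * t ≤ |4 * (M t : ℝ) + 3 - (T t - 2 - k : ℕ)|) :
    Tendsto (fun t : ℕ => √(t : ℝ) * source (M t) (T t - 2 - k)) atTop (𝓝 0) := by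
  have hz : Tendsto (fun t : ℕ => 1 / c ^ 2 / √(t : ℝ)) atTop (𝓝 0) :=
    tendsto_const_nhds.div_atTop tendsto_sqrt_natCast
  refine squeeze_zero' (Eventually.of_forall fun t =>
    mul_nonneg (Real.sqrt_nonneg _) (source_nonneg _ _)) ?_ hz
  filter_upwards [hD, eventually_gt_atTop 0] with t h1 h2
  have h2' : (0 : ℝ) < t := by exact_mod_cast h2
  have hs : ((T t - 2 - k : ℕ) : ℝ) ≤ t := by
    have : T t - 2 - k ≤ t := by have := hT t; omega
    exact_mod_cast this
  -- Chebyshev's inequality bounds the source by 1/(c² t), which is negligible against 1/√t.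
  have h3 := (source_mul_sq_le (M t) (T t - 2 - k)).trans hs
  have h4 : (c * t) ^ 2 ≤ (4 * (M t : ℝ) + 3 - (T t - 2 - k : ℕ)) ^ 2 := by
    rw [← sq_abs (4 * (M t : ℝ) + 3 - (T t - 2 - k : ℕ))]
    gcongr
  have h5 : source (M t) (T t - 2 - k) * (c * t) ^ 2 ≤ t :=
    (mul_le_mul_of_nonneg_left h4 (source_nonneg _ _)).trans h3
  have hsq : √(t : ℝ) * √(t : ℝ) = t := Real.mul_self_sqrt h2'.le
  rw [le_div_iff₀ (Real.sqrt_pos.2 h2'), le_div_iff₀ (by positivity)]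
  calc √(t : ℝ) * source (M t) (T t - 2 - k) * √(t : ℝ) * c ^ 2
      = source (M t) (T t - 2 - k) * (c * t) ^ 2 / t := by
        rw [mul_right_comm (√(t : ℝ)), hsq]
        field_simp
    _ ≤ 1 := by
        rw [div_le_one h2']
        exact h5

theorem tendsto_structureFactor_off_peak (v : ℝ) (x : ℕ → ℤ) (n : ℕ → ℕ) [∀ t, NeZero (n t)]
    (hv1 : v ≠ 1 / 2) (hv2 : v ≠ -(1 / 2)) (hadm : ∀ t, Admissible (n t) (x t) t)
    (hx : Tendsto (fun t : ℕ => (x t : ℝ) / (t : ℝ)) atTop (𝓝 v)) :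
    Tendsto (fun t : ℕ => √(t : ℝ) * structureFactor (n t) (x t) t) atTop (𝓝 0) := by
  have hpos : ∀ᶠ t : ℕ in atTop, 0 < t := eventually_gt_atTop 0
  have ha : Tendsto (fun t : ℕ => ((x t).natAbs : ℝ) / (t : ℝ)) atTop (𝓝 |v|) := by
    refine hx.abs.congr fun t => ?_
    rw [abs_div, Nat.cast_natAbs, Int.cast_abs, Nat.abs_cast]
  -- Slow rays lie in the exponentially damped central region. For |v| ≥ 1/3 the number of trials
  -- grows linearly in t and the source estimate applies.
  rcases lt_or_ge |v| (1 / 3) with hv | hv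
  · have hcentral : ∀ᶠ t : ℕ in atTop, (|x t| : ℝ) < ((t : ℝ) + 1) / 3 := by
      filter_upwards [ha.eventually_lt_const hv, hpos] with t h1 h2
      have h2' : (0 : ℝ) < t := by exact_mod_cast h2
      rw [div_lt_iff₀ h2', Nat.cast_natAbs, Int.cast_abs] at h1
      linarith
    have hex : ∀ t, ∃ T : ℕ, t ≤ T ∧ ((|x t| : ℝ) < ((t : ℝ) + 1) / 3 →
        structureFactor (n t) (x t) t = damped (1 / 4) 0 T) := by
      intro t
      by_cases h : (|x t| : ℝ) < ((t : ℝ) + 1) / 3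
      · obtain ⟨T, hT, -, hp⟩ := structureFactor_eq_damped (hadm t) h
        exact ⟨T, by omega, fun _ => hp⟩
      · exact ⟨t, le_rfl, fun h' => absurd h' h⟩
    choose T hT hp using hex
    refine (tendsto_sqrt_mul_damped hT (1 / 4) 0).congr' ?_
    filter_upwards [hcentral] with t ht
    rw [hp t ht]
  · choose T M hT he hM hp using fun t => exists_profile (hadm t)
    -- The alternative M = 0 covers points on or outside the light cone, where the truncated
    -- subtraction breaks the relation between T, x and M.
    have hcases : ∀ t, T t = (x t).natAbs + 2 * M t + 2 ∨ M t = 0 := by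
      intro t
      obtain ⟨j, hj⟩ := he t
      have h1 := hM t
      have h2 := hT t
      rw [Int.abs_eq_natAbs] at h1
      omega
    have hlow : ∀ᶠ t : ℕ in atTop, (t : ℝ) < 4 * (x t).natAbs := by
      filter_upwards [ha.eventually_const_lt (show (1 / 4 : ℝ) < |v| by linarith), hpos]
        with t h1 h2
      have h2' : (0 : ℝ) < t := by exact_mod_cast h2
      rw [lt_div_iff₀ h2'] at h1
      linarith
    have hvne : 1 - 2 * |v| ≠ 0 := by
      intro h
      have h' : |v| = 1 / 2 := by linarith
      rcases (abs_eq (by norm_num)).1 h' with h | h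
      · exact hv1 h
      · exact hv2 h
    have hTr : ∀ t : ℕ, (t : ℝ) ≤ T t ∧ (T t : ℝ) ≤ t + 1 := by
      intro t
      rcases hT t with h | h <;> rw [h] <;> push_cast <;> constructor <;> linarith
    obtain ⟨c₀, hc₀⟩ : ∃ c₀, c₀ = |1 - 2 * (|v|)| / 2 := ⟨_, rfl⟩
    have hc₀pos : 0 < c₀ := by rw [hc₀]; positivity
    have hfar : ∀ᶠ t : ℕ in atTop, c₀ * t < |(t : ℝ) - 2 * (x t).natAbs| := by
      have h := ((ha.const_mul 2).const_sub 1).abs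
      filter_upwards [h.eventually_const_lt (show c₀ < |1 - 2 * (|v|)| by linarith), hpos]
        with t h1 h2
      have h2' : (0 : ℝ) < t := by exact_mod_cast h2
      have e : 1 - 2 * (((x t).natAbs : ℝ) / t) = ((t : ℝ) - 2 * (x t).natAbs) / t := by
        field_simp
      rw [e, abs_div, Nat.abs_cast, lt_div_iff₀ h2'] at h1
      exact h1
    have hsource : ∀ k : ℕ,
        Tendsto (fun t : ℕ => √(t : ℝ) * source (M t) (T t - 2 - k)) atTop (𝓝 0) := by
      intro k
      -- Inside the cone the deviation differs from t - 2|x| by at most 2 + k, which costs half of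
      -- c₀ for large t. If M = 0, the deviation is T - 5 - k in absolute value, at least t/2.
      have hc : 0 < min (c₀ / 2) (1 / 2) := lt_min (by linarith) (by norm_num)
      refine tendsto_sqrt_mul_source_zero hc k hT ?_
      have hbig := (tendsto_natCast_atTop_atTop (R := ℝ)).eventually_ge_atTop ((2 + k) / (c₀ / 2))
      filter_upwards [hfar, hbig, eventually_ge_atTop (2 * (5 + k))] with t h1 h2 h3
      have h3' : 2 * (5 + (k : ℝ)) ≤ t := by exact_mod_cast h3
      have ht0 : (0 : ℝ) ≤ t := by positivity
      have hk0 : (0 : ℝ) ≤ k := by positivity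
      have hcast : ((T t - 2 - k : ℕ) : ℝ) = T t - 2 - k := by
        have := hT t
        rw [Nat.sub_sub, Nat.cast_sub (by omega)]
        push_cast
        ring
      obtain ⟨hT1, hT2⟩ := hTr t
      rw [hcast]
      rcases hcases t with h | h
      · have h' : (T t : ℝ) = (x t).natAbs + 2 * M t + 2 := by exact_mod_cast h
        rw [div_le_iff₀ (by linarith)] at h2
        have e : 4 * (M t : ℝ) + 3 - (T t - 2 - k) =
            ((t : ℝ) - 2 * (x t).natAbs) - -(T t - t + 1 + k) := by linarith
        have hb : |-((T t : ℝ) - t + 1 + k)| ≤ 2 + k := by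
          rw [abs_neg, abs_of_nonneg (by linarith)]
          linarith
        have h4 := abs_sub_abs_le_abs_sub ((t : ℝ) - 2 * (x t).natAbs) (-(T t - t + 1 + k))
        rw [e]
        have h5 : min (c₀ / 2) (1 / 2) * (t : ℝ) ≤ c₀ / 2 * t :=
          mul_le_mul_of_nonneg_right (min_le_left _ _) ht0
        linarith
      · rw [h, Nat.cast_zero, abs_of_nonpos (by linarith)]
        have h5 : min (c₀ / 2) (1 / 2) * (t : ℝ) ≤ 1 / 2 * t :=
          mul_le_mul_of_nonneg_right (min_le_right _ _) ht0
        linarith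
    have hprof := tendsto_sqrt_mul_profile (M := M) (T := T) (C := 8) (fun t => by
      have := hT t
      omega) (by
        filter_upwards [hlow, eventually_ge_atTop 16] with t h1 h2
        have h2' : (16 : ℝ) ≤ t := by exact_mod_cast h2
        have h3 := (hTr t).1
        rcases hcases t with h | h
        · have h' : (T t : ℝ) = (x t).natAbs + 2 * M t + 2 := by exact_mod_cast h
          linarith
        · rw [h, Nat.cast_zero]
          linarith) hsource
    rw [zero_div] at hprof
    have hprof' := hprof.norm
    rw [norm_zero] at hprof'
    refine squeeze_zero_norm (fun t => ?_) hprof'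
    rw [norm_mul, norm_mul]
    gcongr
    rcases hp t with h | ⟨h, -, -⟩
    · rw [h]
    · rw [h, norm_zero]
      exact norm_nonneg _

end Limits

end Rule54

theorem mainTheorem7 :
    -- the closed form on the sublattice `x + t` even
    (∀ (n : ℕ) [NeZero n] (x : ℤ) (t : ℕ), Rule54.Admissible n x t → Even (x + t) →
        ¬ (x = 0 ∧ t = 0) →
        Rule54.structureFactor n x t = Rule54.closedForm x t) ∧
    -- reduction of the other sublattice to the previous case
    (∀ (n : ℕ) [NeZero n] (x : ℤ) (t : ℕ), Rule54.Admissible n x t → Odd (x + t) →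
        Rule54.structureFactor n x t = Rule54.structureFactor n x (t + 1) ∧
        Rule54.structureFactor n x t = Rule54.closedForm x (t + 1)) ∧
    -- the space-independent expression in the central part of the light cone
    (∀ (n : ℕ) [NeZero n] (x : ℤ) (t : ℕ), Rule54.Admissible n x t → Even (x + t) →
        (|x| : ℝ) < ((t : ℝ) + 1) / 3 →
        ((Rule54.structureFactor n x t : ℝ) : ℂ) =
          (2 : ℂ) ^ (-2 * (t : ℤ) - 3) *
            ((1 + Complex.I / (√7 : ℝ)) * (-1 - Complex.I * (√7 : ℝ)) ^ t +
             (1 - Complex.I / (√7 : ℝ)) * (-1 + Complex.I * (√7 : ℝ)) ^ t)) ∧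
    -- exponential decay there, with the exact rate
    (∃ K : ℝ, ∀ (n : ℕ) [NeZero n] (x : ℤ) (t : ℕ), Rule54.Admissible n x t →
        (|x| : ℝ) < ((t : ℝ) + 1) / 3 →
        |Rule54.structureFactor n x t| ≤ K * (2 : ℝ) ^ (-(t : ℝ) / 2)) ∧
    (∃ c : ℝ, 0 < c ∧ ∃ᶠ t : ℕ in atTop, ∀ (n : ℕ) [NeZero n], Rule54.Admissible n 0 t →
        c * (2 : ℝ) ^ (-(t : ℝ) / 2) ≤ |Rule54.structureFactor n 0 t|) ∧
    -- Gaussian peaks at `x = ± (t / 2 + ζ √t)`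
    (∀ (σ : ℤ) (ζ : ℝ) (x : ℕ → ℤ) (n : ℕ → ℕ) [∀ t, NeZero (n t)], (σ = 1 ∨ σ = -1) →
        (∀ t, Rule54.Admissible (n t) (x t) t) →
        Tendsto (fun t : ℕ => ((σ : ℝ) * (x t : ℝ) - (t : ℝ) / 2) / √(t : ℝ)) atTop (𝓝 ζ) →
        Tendsto (fun t : ℕ => √(t : ℝ) * Rule54.structureFactor (n t) (x t) t) atTop
          (𝓝 (Real.exp (-4 * ζ ^ 2) / (16 * √Real.pi)))) ∧
    -- no other peaks: the rescaled profile vanishes along all rays of velocity other than `± 1 / 2`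
    (∀ (v : ℝ) (x : ℕ → ℤ) (n : ℕ → ℕ) [∀ t, NeZero (n t)], v ≠ 1 / 2 → v ≠ -(1 / 2) →
        (∀ t, Rule54.Admissible (n t) (x t) t) →
        Tendsto (fun t : ℕ => (x t : ℝ) / (t : ℝ)) atTop (𝓝 v) →
        Tendsto (fun t : ℕ => √(t : ℝ) * Rule54.structureFactor (n t) (x t) t) atTop (𝓝 0)) := by
  refine ⟨fun n _ x t h hxt h0 => Rule54.structureFactor_eq_closedForm h hxt h0,
    fun n _ x t h hxt => Rule54.structureFactor_odd h hxt, fun n _ x t h hxt hx => ?_,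
    Rule54.exists_structureFactor_decay, Rule54.exists_structureFactor_ge,
    fun σ ζ x n _ hσ hadm hx => Rule54.tendsto_structureFactor_peak σ ζ x n hσ hadm hx,
    fun v x n _ hv1 hv2 hadm hx => Rule54.tendsto_structureFactor_off_peak v x n hv1 hv2 hadm hx⟩
  rw [Rule54.structureFactor_eq_damped_of_even h hxt hx, Rule54.damped_eq_complex]
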